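/- Fix a dyadic lattice $\mathcal D$ on $\mathbb R$: for some $a\in\mathbb R$, $\ell>0$, it consists of the intervals $[a+\ell2^{-n}m,\;a+\ell2^{-n}(m+1))$, $n,m\in\mathbb Z$. For $I\in\mathcal D$ let $\mathcal D(I)=\{J\in\mathcal D: J\subseteq I\}$. A weight is a locally integrable function on $\mathbb R$ that is positive almost everywhere; below, $w$ always denotes a weight such that $w^{-1}$ is also a weight. Write $\langle w\rangle_J=\frac1{|J|}\int_J w$ and $\Delta_Jw=\langle w\rangle_{J^-}-\langle w\rangle_{J^+}$, where $J^\pm$ are the two halves of $J$. Put $[w]_{A_2^d}=\sup_{J\in\mathcal D}\langle w\rangle_J\langle w^{-1}\rangle_J$, and write $w\in A_2^d$ if this is finite. A non-negative sequence $\{c_J\}_{J\in\mathcal D}$ is Carleson if there is $C<\infty$ with $\frac1{|I|}\sum_{J\in\mathcal D(I)}c_J\le C$ for all $I\in\mathcal D$; the smallest such $C$ is its Carleson norm $\|\{c_J\}\|_{\mathcal C}$ (set equal to $\infty$ if the sequence is not Carleson). For $\alpha\in\mathbb R$ let $$c^{(\alpha)}_J(w)=|J|\,\langle w\rangle_J^\alpha\langle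 w^{-1}\rangle_J^\alpha\left[\frac{(\Delta_Jw)^2}{\langle w\rangle_J^2}+\frac{(\Delta_Jw^{-1})^2}{\langle w^{-1}\rangle_J^2}\right],$$ and for $\alpha>0$, $Q\ge1$ let $$k_\alpha(Q)=\begin{cases}\frac8\alpha\,(Q^\alpha-1),&\alpha\ge1,\\ 8\,(Q^\alpha-Q^{\alpha-1}),&0<\alpha<1.\end{cases}$$ (i) Let $\alpha>0$. Then $k_\alpha$ is a bijection of $[1,\infty)$ onto $[0,\infty)$; denote its inverse by $k_\alpha^{-1}:[0,\infty)\to[1,\infty)$. If $\{c^{(\alpha)}_J(w)\}$ is a Carleson sequence, then $w\in A_2^d$ and $$[w]_{A_2^d}\le k_\alpha^{-1}\big(\|\{c^{(\alpha)}_J(w)\}\|_{\mathcal C}\big).$$ This estimate is sharp: for every $B\ge0$, $$\sup\big\{[w]_{A_2^d}:\ \|\{c^{(\alpha)}_J(w)\}\|_{\mathcal C}=B\big\}=k_\alpha^{-1}(B),$$ and for every $Q\ge1$, $$\inf\big\{\|\{c^{(\alpha)}_J(w)\}\|_{\mathcal C}:\ [w]_{A_2^d}=Q\big\}=k_\alpha(Q).$$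 (ii) Let $\alpha\le0$. Then there exists a weight $w$, with $w^{-1}$ also a weight, such that $w\notin A_2^d$ and $\{c^{(\alpha)}_J(w)\}$ is a Carleson sequence. -/

import Mathlib

open MeasureTheory Set
open scoped ENNReal

noncomputable section

/-- A dyadic lattice on the line, determined by the position (left endpoint) and the size of its
root interval. -/
structure DyadicLattice where
  /-- left endpoint of the root interval -/
  pos : ℝ
  /-- length of the root interval -/
  size : ℝ
  size_pos : 0 < size

namespace DyadicLattice

/-- The length of the intervals of generation `n ∈ ℤ` of the lattice. -/
def len (D : DyadicLattice) (n : ℤ) : ℝ := D.size * (2 : ℝ) ^ (-n)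

/-- The intervals of the lattice, indexed injectively by generation `n` and position `m`. -/
def ivl (D : DyadicLattice) (J : ℤ × ℤ) : Set ℝ :=
  Ico (D.pos + D.len J.1 * J.2) (D.pos + D.len J.1 * (J.2 + 1))

end DyadicLattice

/-- (The index of) the left half of the interval `J`. -/
def leftHalf (J : ℤ × ℤ) : ℤ × ℤ := (J.1 + 1, 2 * J.2)

/-- (The index of) the right half of the interval `J`. -/
def rightHalf (J : ℤ × ℤ) : ℤ × ℤ := (J.1 + 1, 2 * J.2 + 1)

/-- A weight on the line: locally integrable and positive almost everywhere. -/
def IsWeight (w : ℝ → ℝ) : Prop :=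
  LocallyIntegrable w volume ∧ ∀ᵐ x ∂(volume : Measure ℝ), 0 < w x

/-- The average `⟨w⟩_J` of `w` over the interval `J` of the lattice. -/
def avg (D : DyadicLattice) (w : ℝ → ℝ) (J : ℤ × ℤ) : ℝ := ⨍ x in D.ivl J, w x

/-- The difference `Δ_J w` of the averages over the two halves of `J`. -/
def avgDiff (D : DyadicLattice) (w : ℝ → ℝ) (J : ℤ × ℤ) : ℝ :=
  avg D w (leftHalf J) - avg D w (rightHalf J)

/-- The dyadic `A₂`-characteristic of `w`, as an extended nonnegative real. -/
def A2Char (D : DyadicLattice) (w : ℝ → ℝ) : ℝ≥0∞ :=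
  ⨆ J : ℤ × ℤ, ENNReal.ofReal (avg D w J * avg D w⁻¹ J)

/-- Membership in the dyadic Muckenhoupt class `A₂`; both `w` and its reciprocal are weights. -/
def InA2 (D : DyadicLattice) (w : ℝ → ℝ) : Prop :=
  IsWeight w ∧ IsWeight w⁻¹ ∧ A2Char D w < ∞

/-- The sum of `c` over all intervals of the lattice contained in `I`, divided by `|I|`. -/
def carlesonAvg (D : DyadicLattice) (c : ℤ × ℤ → ℝ) (I : ℤ × ℤ) : ℝ≥0∞ :=
  (∑' J : {J : ℤ × ℤ // D.ivl J ⊆ D.ivl I}, ENNReal.ofReal (c J)) / volume (D.ivl I)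

/-- `c` is a Carleson sequence over the lattice `D`. -/
def IsCarleson (D : DyadicLattice) (c : ℤ × ℤ → ℝ) : Prop :=
  (∀ J, 0 ≤ c J) ∧ ∃ C : ℝ≥0∞, C < ∞ ∧ ∀ I, carlesonAvg D c I ≤ C

/-- The Carleson norm: the smallest `C` that bounds all `carlesonAvg D c I`. -/
def carlesonNorm (D : DyadicLattice) (c : ℤ × ℤ → ℝ) : ℝ≥0∞ :=
  sInf {C : ℝ≥0∞ | ∀ I, carlesonAvg D c I ≤ C}

/-- The sequence `c_J^{(α)}(w)`. -/
def cSeq (D : DyadicLattice) (α : ℝ) (w : ℝ → ℝ) (J : ℤ × ℤ) : ℝ :=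
  D.len J.1 * avg D w J ^ α * avg D w⁻¹ J ^ α *
    (avgDiff D w J ^ 2 / avg D w J ^ 2 + avgDiff D w⁻¹ J ^ 2 / avg D w⁻¹ J ^ 2)

/-- The function `k_α` on `[1, ∞)`. -/
def kFun (α Q : ℝ) : ℝ :=
  if 1 ≤ α then 8 / α * (Q ^ α - 1) else 8 * (Q ^ α - Q ^ (α - 1))

/-- The inverse of `k_α : [1, ∞) → [0, ∞)`. -/
def kInv (α : ℝ) : ℝ → ℝ := Function.invFunOn (kFun α) (Ici 1)

end

/-! Let `t_J = ⟨w⟩_J ⟨w⁻¹⟩_J ≥ 1` (`localChar`). If `a`, `b` are the relative half-differences of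
`w`, `w⁻¹` on `J`, the halves have characteristics `t_J (1 ± a)(1 ± b)` and `c_J / |J| = 4 t_J^α (a²
+ b²)`. Suppose `f(t_J)` is at most the mean of `f` over the two halves plus `c_J / |J|`. Iterating
bounds `f(t_I)` by the mean of `f` over the `n`-th generation plus a partial Carleson sum. When
`f(t) ≤ K (√t - 1)`, that mean can be made arbitrarily small, by Lebesgue differentiation and Fatou
(`exists_sum_sqrt_localChar_le`), so `f(t_I)` is at most the Carleson average over `I`
(`ofReal_le_carlesonAvg`).

A small power of `t` as `f` shows that `Q = [w]` is finite. Then `f = (8/α)(t^α - 1)` for `α ≥ 1`,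
or `f = 8 Q^(α-1) (t - 1)` for `α < 1`, gives `k_α(Q) ≤ ‖c‖` (`kFun_A2Char_le`).

Sharpness comes from Riesz products, for which `b = -a` at every active step and `t_J` depends only
on the generation (`exists_weight_rieszNorm`). For `α ≥ 1`, many small steps approach `k_α(Q)`; for
`α < 1`, a single step attains it.

For `α ≤ 0`, `t^α ≤ 1` gives `c_J ≤ 8|J|`. A weight with ever higher spikes at ever larger scales,
nonconstant on at most two intervals of each generation, is therefore Carleson without being in
`A₂`. -/

noncomputable section

open Filter Topology

/-! ### Combinatorics of the dyadic lattice -/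

namespace DyadicLattice

variable (D : DyadicLattice)

lemma len_pos (n : ℤ) : 0 < D.len n :=
  mul_pos D.size_pos (zpow_pos two_pos _)

lemma len_add (n : ℤ) (k : ℕ) : 2 ^ k * D.len (n + k) = D.len n := by
  unfold len
  have h : (2 : ℝ) ^ (-n) = 2 ^ k * 2 ^ (-(n + k)) := by
    rw [← zpow_natCast, ← zpow_add₀ two_ne_zero]
    congr 1
    ring
  rw [h]
  ring

lemma len_succ (n : ℤ) : D.len n = 2 * D.len (n + 1) := by
  simpa using (D.len_add n 1).symm

lemma len_strictAnti : StrictAnti D.len := by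
  refine strictAnti_int_of_succ_lt fun n => ?_
  have := D.len_pos (n + 1)
  have := D.len_succ n
  linarith

/-- The position of the interval of generation `n` that contains `x`. -/
def idx (n : ℤ) (x : ℝ) : ℤ := ⌊(x - D.pos) / D.len n⌋

lemma mem_ivl_iff {x : ℝ} {J : ℤ × ℤ} : x ∈ D.ivl J ↔ D.idx J.1 x = J.2 := by
  have h := D.len_pos J.1
  rw [idx, Int.floor_eq_iff, le_div_iff₀ h, div_lt_iff₀ h, ivl, mem_Ico]
  constructor <;> rintro ⟨h1, h2⟩ <;> constructor <;> linarith

lemma mem_ivl_idx (n : ℤ) (x : ℝ) : x ∈ D.ivl (n, D.idx n x) := D.mem_ivl_iff.2 rfl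

lemma measurable_idx (n : ℤ) : Measurable (D.idx n) := by
  unfold idx
  fun_prop

lemma measurableSet_ivl (J : ℤ × ℤ) : MeasurableSet (D.ivl J) := measurableSet_Ico

lemma volume_ivl (J : ℤ × ℤ) : volume (D.ivl J) = ENNReal.ofReal (D.len J.1) := by
  rw [ivl, Real.volume_Ico]
  congr 1
  ring

lemma volume_real_ivl (J : ℤ × ℤ) : volume.real (D.ivl J) = D.len J.1 := by
  rw [Measure.real, volume_ivl, ENNReal.toReal_ofReal (D.len_pos _).le]

/-- Floors commute with division by a natural number. All nesting of dyadic intervals is derived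
from this. -/
lemma idx_add (n : ℤ) (k : ℕ) (x : ℝ) : D.idx n x = D.idx (n + k) x / 2 ^ k := by
  have h2 : (0 : ℝ) < 2 ^ k := by positivity
  have h := D.len_pos (n + k)
  have : (x - D.pos) / D.len n = (x - D.pos) / D.len (n + k) / ((2 ^ k : ℕ) : ℝ) := by
    rw [← D.len_add n k]
    push_cast
    field_simp
  rw [idx, idx, this, Int.floor_div_natCast]
  push_cast
  rfl

end DyadicLattice

/-- The `j`-th descendant of `I` in the `k`-th generation below `I`. -/
def descendant (I : ℤ × ℤ) (k j : ℕ) : ℤ × ℤ := (I.1 + k, 2 ^ k * I.2 + j)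

lemma descendant_zero (I : ℤ × ℤ) : descendant I 0 0 = I := by
  simp [descendant]

lemma leftHalf_descendant (I : ℤ × ℤ) (k j : ℕ) :
    leftHalf (descendant I k j) = descendant I (k + 1) (2 * j) := by
  simp only [leftHalf, descendant, Prod.mk.injEq]
  constructor <;> push_cast <;> ring

lemma rightHalf_descendant (I : ℤ × ℤ) (k j : ℕ) :
    rightHalf (descendant I k j) = descendant I (k + 1) (2 * j + 1) := by
  simp only [rightHalf, descendant, Prod.mk.injEq]
  constructor <;> push_cast <;> ring

namespace DyadicLattice

variable (D : DyadicLattice)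

lemma mem_ivl_iff_descendant {x : ℝ} {I : ℤ × ℤ} (k : ℕ) :
    x ∈ D.ivl I ↔ ∃ j ∈ Finset.range (2 ^ k), x ∈ D.ivl (descendant I k j) := by
  simp only [mem_ivl_iff, descendant, D.idx_add I.1 k x, Finset.mem_range]
  have hk : (0 : ℤ) < 2 ^ k := by positivity
  constructor
  · intro h
    have h1 := Int.mul_ediv_add_emod (D.idx (I.1 + k) x) (2 ^ k)
    have h2 := Int.emod_nonneg (D.idx (I.1 + k) x) hk.ne'
    have h3 := Int.emod_lt_of_pos (D.idx (I.1 + k) x) hk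
    refine ⟨(D.idx (I.1 + k) x % 2 ^ k).toNat, ?_, ?_⟩
    · zify
      rwa [Int.toNat_of_nonneg h2]
    · rw [Int.toNat_of_nonneg h2, ← h, h1]
  · rintro ⟨j, hj, h⟩
    rw [h, Int.add_comm, Int.add_mul_ediv_left _ _ hk.ne', Int.ediv_eq_zero_of_lt (by positivity)
      (by exact_mod_cast hj), zero_add]

lemma ivl_eq_biUnion (I : ℤ × ℤ) (k : ℕ) :
    D.ivl I = ⋃ j ∈ Finset.range (2 ^ k), D.ivl (descendant I k j) := by
  ext x
  rw [D.mem_ivl_iff_descendant k]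
  simp

lemma pairwiseDisjoint_descendant (I : ℤ × ℤ) (k : ℕ) (s : Set ℕ) :
    s.PairwiseDisjoint fun j => D.ivl (descendant I k j) := by
  intro i _ j _ hij
  refine Set.disjoint_left.2 fun x hx hy => hij ?_
  rw [mem_ivl_iff] at hx hy
  simp only [descendant] at hx hy
  rw [hx] at hy
  simpa using hy

lemma ivl_subset_iff {J I : ℤ × ℤ} :
    D.ivl J ⊆ D.ivl I ↔ ∃ k : ℕ, ∃ j ∈ Finset.range (2 ^ k), J = descendant I k j := by
  constructor
  · intro h
    have hl := D.len_pos J.1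
    have hs := h
    rw [ivl, ivl, Ico_subset_Ico_iff (by nlinarith)] at h
    have hlen : D.len J.1 ≤ D.len I.1 := by nlinarith [h.1, h.2]
    have hn : I.1 ≤ J.1 := D.len_strictAnti.le_iff_ge.1 hlen
    obtain ⟨k, hk⟩ := Int.le.dest hn
    -- The left endpoint of `J` lies in exactly one interval of its generation, so the descendant of
    -- `I` containing it must be `J`.
    have hx := D.mem_ivl_idx J.1 (D.pos + D.len J.1 * J.2)
    have hxJ : D.pos + D.len J.1 * J.2 ∈ D.ivl J := ⟨le_rfl, by nlinarith⟩
    obtain ⟨j, hj, hxj⟩ := (D.mem_ivl_iff_descendant k).1 (hs hxJ)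
    refine ⟨k, j, hj, ?_⟩
    rw [mem_ivl_iff] at hxJ hxj
    simp only [descendant] at hxj ⊢
    rw [hk, hxJ] at hxj
    exact Prod.ext hk.symm hxj
  · rintro ⟨k, j, hj, rfl⟩ x hx
    exact (D.mem_ivl_iff_descendant k).2 ⟨j, hj, hx⟩

lemma tsum_ivl_subset (g : ℤ × ℤ → ℝ≥0∞) (I : ℤ × ℤ) :
    ∑' J : {J : ℤ × ℤ // D.ivl J ⊆ D.ivl I}, g J =
      ∑' k : ℕ, ∑ j ∈ Finset.range (2 ^ k), g (descendant I k j) := by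
  let F : (Σ k : ℕ, Fin (2 ^ k)) → {J : ℤ × ℤ // D.ivl J ⊆ D.ivl I} := fun p =>
    ⟨descendant I p.1 p.2, D.ivl_subset_iff.2 ⟨p.1, p.2, by simp, rfl⟩⟩
  have hF : Function.Bijective F := by
    constructor
    · rintro ⟨k, i⟩ ⟨l, j⟩ h
      simp only [F, descendant, Subtype.mk.injEq, Prod.mk.injEq, add_right_inj,
        Nat.cast_inj] at h
      obtain ⟨rfl, h⟩ := h
      simp only [add_right_inj, Nat.cast_inj, Fin.val_inj] at h
      rw [h]
    · rintro ⟨J, hJ⟩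
      obtain ⟨k, j, hj, rfl⟩ := D.ivl_subset_iff.1 hJ
      exact ⟨⟨k, ⟨j, Finset.mem_range.1 hj⟩⟩, rfl⟩
  rw [← (Equiv.ofBijective F hF).tsum_eq, ENNReal.tsum_sigma']
  refine tsum_congr fun k => ?_
  rw [tsum_fintype, Finset.sum_range]
  rfl

end DyadicLattice

lemma sum_range_two_mul {M : Type*} [AddCommMonoid M] (g : ℕ → M) (n : ℕ) :
    ∑ i ∈ Finset.range (2 * n), g i = ∑ j ∈ Finset.range n, (g (2 * j) + g (2 * j + 1)) := by
  induction n with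
  | zero => simp
  | succ n ih =>
    rw [Nat.mul_succ, Finset.sum_range_succ, Finset.sum_range_succ, ih, Finset.sum_range_succ,
      add_assoc]

/-! ### Averages, the local characteristic and Lebesgue differentiation -/

section Averages

variable {D : DyadicLattice} {w : ℝ → ℝ}

lemma avg_eq (D : DyadicLattice) (w : ℝ → ℝ) (J : ℤ × ℤ) :
    avg D w J = (D.len J.1)⁻¹ * ∫ x in D.ivl J, w x := by
  rw [avg, setAverage_eq, D.volume_real_ivl, smul_eq_mul]

lemma avg_of_eqOn {c : ℝ} {J : ℤ × ℤ} (h : ∀ x ∈ D.ivl J, w x = c) : avg D w J = c := by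
  rw [avg_eq, setIntegral_congr_fun (D.measurableSet_ivl J) h, setIntegral_const,
    D.volume_real_ivl, smul_eq_mul, inv_mul_cancel_left₀ (D.len_pos _).ne']

lemma MeasureTheory.LocallyIntegrable.integrableOn_ivl (hw : LocallyIntegrable w volume)
    (D : DyadicLattice) (J : ℤ × ℤ) : IntegrableOn w (D.ivl J) :=
  (hw.integrableOn_isCompact isCompact_Icc).mono_set Ico_subset_Icc_self

lemma two_pow_mul_avg (hw : LocallyIntegrable w volume) (I : ℤ × ℤ) (k : ℕ) :
    2 ^ k * avg D w I = ∑ j ∈ Finset.range (2 ^ k), avg D w (descendant I k j) := by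
  have h1 := D.len_pos (I.1 + k)
  simp only [avg_eq]
  rw [D.ivl_eq_biUnion I k, integral_biUnion_finset _ (fun j _ => D.measurableSet_ivl _)
    (D.pairwiseDisjoint_descendant I k _) (fun j _ => hw.integrableOn_ivl D _), ← D.len_add I.1 k,
    ← mul_assoc, Finset.mul_sum]
  refine Finset.sum_congr rfl fun j _ => ?_
  simp only [descendant]
  field_simp

lemma avg_eq_half (hw : LocallyIntegrable w volume) (J : ℤ × ℤ) :
    avg D w J = (avg D w (leftHalf J) + avg D w (rightHalf J)) / 2 := by
  have h := two_pow_mul_avg (D := D) hw J 1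
  have hl := leftHalf_descendant J 0 0
  have hr := rightHalf_descendant J 0 0
  rw [descendant_zero] at hl hr
  simp only [pow_one, Finset.sum_range_succ, Finset.sum_range_zero] at h
  rw [hl, hr]
  simp only [mul_zero, zero_add] at h ⊢
  linarith

lemma IsWeight.avg_pos (hw : IsWeight w) (D : DyadicLattice) (J : ℤ × ℤ) : 0 < avg D w J := by
  rw [avg_eq]
  refine mul_pos (inv_pos.2 (D.len_pos _)) ?_
  have h0 : 0 ≤ᵐ[volume.restrict (D.ivl J)] w :=
    (ae_restrict_of_ae hw.2).mono fun x hx => le_of_lt hx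
  rw [integral_pos_iff_support_of_nonneg_ae h0 (hw.1.integrableOn_ivl D J)]
  have h1 : (Function.support w : Set ℝ) =ᵐ[volume.restrict (D.ivl J)] univ := by
    refine eventuallyEq_univ.2 ?_
    filter_upwards [ae_restrict_of_ae hw.2] with x hx using hx.ne'
  rw [measure_congr h1, Measure.restrict_apply_univ, D.volume_ivl]
  exact ENNReal.ofReal_pos.2 (D.len_pos _)

/-- The product `⟨w⟩_J ⟨w⁻¹⟩_J`. -/
def localChar (D : DyadicLattice) (w : ℝ → ℝ) (J : ℤ × ℤ) : ℝ := avg D w J * avg D w⁻¹ J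

/-- Integrate the pointwise AM-GM inequality `2 ≤ w / x + x / w` with `x = ⟨w⟩_J`. -/
lemma one_le_localChar (hw : IsWeight w) (hv : IsWeight w⁻¹) (D : DyadicLattice) (J : ℤ × ℤ) :
    1 ≤ localChar D w J := by
  have hx := hw.avg_pos D J
  have hl := D.len_pos J.1
  set x := avg D w J with hxdef
  have hwi := hw.1.integrableOn_ivl D J
  have hvi := hv.1.integrableOn_ivl D J
  have h : ∫ _ in D.ivl J, (2 : ℝ) ≤ ∫ y in D.ivl J, (x⁻¹ * w y + x * w⁻¹ y) := by
    refine integral_mono_ae (integrableOn_const (by simp [D.volume_ivl]))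
      ((hwi.const_mul _).add (hvi.const_mul _)) ?_
    filter_upwards [ae_restrict_of_ae hw.2] with y hy
    have h1 : x⁻¹ * w y * (x * (w y)⁻¹) = 1 := by field_simp
    have h2 : 0 < x⁻¹ * w y := by positivity
    have h3 : 0 < x * (w y)⁻¹ := by positivity
    simp only [Pi.inv_apply]
    nlinarith [sq_nonneg (x⁻¹ * w y - x * (w y)⁻¹)]
  rw [integral_add (hwi.const_mul _) (hvi.const_mul _), integral_const_mul, integral_const_mul,
    setIntegral_const, D.volume_real_ivl, smul_eq_mul] at h
  have e1 : ∫ y in D.ivl J, w y = D.len J.1 * x := by rw [hxdef, avg_eq]; field_simp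
  have e2 : ∫ y in D.ivl J, w⁻¹ y = D.len J.1 * avg D w⁻¹ J := by rw [avg_eq]; field_simp
  rw [e1, e2] at h
  have e3 : x⁻¹ * (D.len J.1 * x) = D.len J.1 := by field_simp
  rw [e3] at h
  have : D.len J.1 * 1 ≤ D.len J.1 * (x * avg D w⁻¹ J) := by linarith
  exact le_of_mul_le_mul_left this hl

lemma tendsto_len (D : DyadicLattice) (n : ℤ) :
    Tendsto (fun k : ℕ => D.len (n + k)) atTop (𝓝 0) := by
  have h : ∀ k : ℕ, D.len (n + k) = D.len n * (1 / 2) ^ k := fun k => by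
    rw [← D.len_add n k, one_div, inv_pow]
    field_simp
  simp only [h]
  simpa using (tendsto_pow_atTop_nhds_zero_of_lt_one (r := (1 / 2 : ℝ)) (by norm_num)
    (by norm_num)).const_mul (D.len n)

/-- Up to a null set, a dyadic interval is the closed ball about its midpoint, so Lebesgue
differentiation along balls containing `x` applies. -/
lemma ae_tendsto_avg (hw : LocallyIntegrable w volume) (D : DyadicLattice) (n : ℤ) :
    ∀ᵐ x, Tendsto (fun k : ℕ => avg D w (n + k, D.idx (n + k) x)) atTop (𝓝 (w x)) := by
  filter_upwards [IsUnifLocDoublingMeasure.ae_tendsto_average (μ := volume) hw 1] with x hx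
  have h := hx (l := atTop)
    (fun k : ℕ => D.pos + D.len (n + k) * D.idx (n + k) x + D.len (n + k) / 2)
    (fun k : ℕ => D.len (n + k) / 2) ?_ ?_
  · refine h.congr fun k => ?_
    rw [avg, Real.closedBall_eq_Icc, setAverage_eq, setAverage_eq]
    have hset : D.ivl (n + k, D.idx (n + k) x) =ᵐ[volume]
        Icc (D.pos + D.len (n + k) * D.idx (n + k) x + D.len (n + k) / 2 - D.len (n + k) / 2)
          (D.pos + D.len (n + k) * D.idx (n + k) x + D.len (n + k) / 2 + D.len (n + k) / 2) := by
      rw [add_sub_cancel_right, show ∀ a l m : ℝ, a + l * m + l / 2 + l / 2 = a + l * (m + 1) by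
        intros; ring]
      exact Ico_ae_eq_Icc
    rw [setIntegral_congr_set hset, measureReal_congr hset]
  · refine tendsto_nhdsWithin_iff.2 ⟨by simpa using (tendsto_len D n).div_const 2, ?_⟩
    exact Eventually.of_forall fun k => half_pos (D.len_pos _)
  · refine Eventually.of_forall fun k => ?_
    obtain ⟨h1, h2⟩ := D.mem_ivl_idx (n + k) x
    simp only at h1 h2
    rw [Real.closedBall_eq_Icc]
    constructor <;> linarith

lemma lintegral_comp_idx (D : DyadicLattice) (g : ℤ × ℤ → ℝ≥0∞) (I : ℤ × ℤ) (k : ℕ) :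
    ∫⁻ x in D.ivl I, g (I.1 + k, D.idx (I.1 + k) x) =
      ∑ j ∈ Finset.range (2 ^ k), g (descendant I k j) * ENNReal.ofReal (D.len (I.1 + k)) := by
  rw [D.ivl_eq_biUnion I k, lintegral_biUnion_finset (D.pairwiseDisjoint_descendant I k _)
    fun j _ => D.measurableSet_ivl _]
  refine Finset.sum_congr rfl fun j _ => ?_
  have h : EqOn (fun x => g (I.1 + k, D.idx (I.1 + k) x)) (fun _ => g (descendant I k j))
      (D.ivl (descendant I k j)) := fun x hx => by
    have := D.mem_ivl_iff.1 hx
    simp only [descendant] at this ⊢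
    rw [this]
  rw [setLIntegral_congr_fun (D.measurableSet_ivl _) h, setLIntegral_const, D.volume_ivl]
  rfl

/-- The mean of `√(⟨w⟩_J ⟨w⁻¹⟩_J)` over the `k`-th generation of descendants gets close to `1`. -/
lemma exists_sum_sqrt_localChar_le (hw : IsWeight w) (hv : IsWeight w⁻¹) (D : DyadicLattice)
    (I : ℤ × ℤ) {ε : ℝ} (hε : 0 < ε) :
    ∃ k : ℕ, ∑ j ∈ Finset.range (2 ^ k), √(localChar D w (descendant I k j)) ≤
      2 ^ k * (1 + ε) := by
  by_contra! hcon
  set X := (avg D w I + avg D w⁻¹ I) / 2 with hX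
  -- The arithmetic mean has the same average `X` on every generation and dominates the square root.
  -- Fatou applied to the nonnegative gap `g` thus bounds the square root from above; this is why
  -- `√t` appears rather than `t`.
  let g : ℤ × ℤ → ℝ := fun J => (avg D w J + avg D w⁻¹ J) / 2 - √(localChar D w J)
  have hg : ∀ J, 0 ≤ g J := fun J => by
    have h1 := (hw.avg_pos D J).le
    have h2 := (hv.avg_pos D J).le
    have : √(localChar D w J) ≤ (avg D w J + avg D w⁻¹ J) / 2 := by
      refine Real.sqrt_le_iff.2 ⟨by positivity, ?_⟩
      rw [localChar]
      nlinarith [sq_nonneg (avg D w J - avg D w⁻¹ J)]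
    simp only [g]
    linarith
  have hl := D.len_pos I.1
  have hsum : ∀ k : ℕ, ∑ j ∈ Finset.range (2 ^ k), g (descendant I k j) ≤
      2 ^ k * (X - 1 - ε) := fun k => by
    have h1 := two_pow_mul_avg (D := D) hw.1 I k
    have h2 := two_pow_mul_avg (D := D) hv.1 I k
    have h3 := hcon k
    simp only [g]
    rw [Finset.sum_sub_distrib, ← Finset.sum_div, Finset.sum_add_distrib, ← h1, ← h2, hX]
    linarith
  -- Keeps `ENNReal.ofReal` from truncating in the final comparison.
  have hnn : 0 ≤ X - 1 - ε := by
    have := (Finset.sum_nonneg fun j _ => hg _).trans (hsum 0)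
    simpa using this
  have hint : ∀ k : ℕ, ∫⁻ x in D.ivl I, ENNReal.ofReal (g (I.1 + k, D.idx (I.1 + k) x)) ≤
      ENNReal.ofReal (D.len I.1 * (X - 1 - ε)) := fun k => by
    rw [lintegral_comp_idx D (fun J => ENNReal.ofReal (g J)), ← Finset.sum_mul,
      ← ENNReal.ofReal_sum_of_nonneg fun j _ => hg _,
      ← ENNReal.ofReal_mul (Finset.sum_nonneg fun j _ => hg _)]
    refine ENNReal.ofReal_le_ofReal ?_
    have := mul_le_mul_of_nonneg_right (hsum k) (D.len_pos (I.1 + k)).le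
    rw [← D.len_add I.1 k]
    linarith
  have hfatou := lintegral_liminf_le (μ := volume.restrict (D.ivl I)) (u := atTop)
    (f := fun (k : ℕ) x => ENNReal.ofReal (g (I.1 + k, D.idx (I.1 + k) x))) fun k => by
      have : Measurable fun m : ℤ => ENNReal.ofReal (g (I.1 + k, m)) := measurable_of_countable _
      exact this.comp (D.measurable_idx _)
  have hup : liminf (fun k : ℕ => ∫⁻ x in D.ivl I,
      ENNReal.ofReal (g (I.1 + k, D.idx (I.1 + k) x))) atTop ≤
      ENNReal.ofReal (D.len I.1 * (X - 1 - ε)) :=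
    (liminf_le_liminf (Eventually.of_forall hint)).trans (by simp)
  have hlim : ∀ᵐ x ∂volume.restrict (D.ivl I),
      liminf (fun k : ℕ => ENNReal.ofReal (g (I.1 + k, D.idx (I.1 + k) x))) atTop =
        ENNReal.ofReal ((w x + w⁻¹ x) / 2 - 1) := by
    filter_upwards [ae_restrict_of_ae hw.2, ae_restrict_of_ae (ae_tendsto_avg hw.1 D I.1),
      ae_restrict_of_ae (ae_tendsto_avg hv.1 D I.1)] with x h0 h1 h2
    refine Tendsto.liminf_eq (ENNReal.tendsto_ofReal ?_)
    have h3 := ((h1.add h2).div_const 2).sub (h1.mul h2).sqrt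
    rwa [show w x * w⁻¹ x = 1 from mul_inv_cancel₀ h0.ne', Real.sqrt_one] at h3
  have hwi := hw.1.integrableOn_ivl D I
  have hvi := hv.1.integrableOn_ivl D I
  have hci : IntegrableOn (fun _ : ℝ => (1 : ℝ)) (D.ivl I) :=
    integrableOn_const (by simp [D.volume_ivl])
  have hval : ∫⁻ x in D.ivl I, ENNReal.ofReal ((w x + w⁻¹ x) / 2 - 1) =
      ENNReal.ofReal (D.len I.1 * (X - 1)) := by
    have hadd : Integrable (fun x => (w x + w⁻¹ x) / 2) (volume.restrict (D.ivl I)) :=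
      (hwi.add hvi).div_const 2
    have hsub : Integrable (fun x => (w x + w⁻¹ x) / 2 - 1) (volume.restrict (D.ivl I)) :=
      hadd.sub hci
    rw [← ofReal_integral_eq_lintegral_ofReal hsub]
    · congr 1
      rw [integral_sub hadd hci, integral_div, integral_add hwi hvi,
        setIntegral_const, D.volume_real_ivl, hX, avg_eq, avg_eq]
      simp only [smul_eq_mul]
      field_simp
    · filter_upwards [ae_restrict_of_ae hw.2] with x hx
      have h1 : w x * (w x)⁻¹ = 1 := mul_inv_cancel₀ hx.ne'
      have h2 : 0 < (w x)⁻¹ := inv_pos.2 hx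
      simp only [Pi.zero_apply, Pi.inv_apply]
      nlinarith [sq_nonneg (w x - (w x)⁻¹)]
  -- Fatou now reads `|I| (X - 1) ≤ |I| (X - 1 - ε)`, which is absurd.
  rw [lintegral_congr_ae hlim, hval] at hfatou
  have hfin := hfatou.trans hup
  rw [ENNReal.ofReal_le_ofReal_iff (by positivity)] at hfin
  nlinarith

end Averages

/-! ### One-step inequalities for the Bellman functions -/

section OneStep

/-- By AM-GM the mean of the two `β`-th powers is at least `((1 - a²)(1 - b²))^(β/2)`. The base is
at most `1` and `β/2 ≤ 1`, so this is at least `(1 - a²)(1 - b²) ≥ 1 - a² - b²`. -/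
lemma four_mul_rpow_sub_one_le {t a b β : ℝ} (ht : 0 < t) (ha : |a| < 1) (hb : |b| < 1)
    (hβ2 : β ≤ 2) :
    4 * (t ^ β - 1) ≤ (4 * ((t * ((1 + a) * (1 + b))) ^ β - 1) +
      4 * ((t * ((1 - a) * (1 - b))) ^ β - 1)) / 2 + t ^ β * (4 * (a ^ 2 + b ^ 2)) := by
  obtain ⟨ha1, ha2⟩ := abs_lt.1 ha
  obtain ⟨hb1, hb2⟩ := abs_lt.1 hb
  have hu : 0 < (1 + a) * (1 + b) := mul_pos (by linarith) (by linarith)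
  have hv : 0 < (1 - a) * (1 - b) := mul_pos (by linarith) (by linarith)
  have hsq : ∀ u : ℝ, 0 < u → u ^ β = (u ^ (β / 2)) ^ 2 := fun u h => by
    rw [← Real.rpow_natCast, ← Real.rpow_mul h.le]
    norm_num
  have hprod : ((1 + a) * (1 + b)) * ((1 - a) * (1 - b)) ≤
      ((1 + a) * (1 + b)) ^ (β / 2) * ((1 - a) * (1 - b)) ^ (β / 2) := by
    rw [← Real.mul_rpow hu.le hv.le]
    refine Real.self_le_rpow_of_le_one (mul_pos hu hv).le ?_ (by linarith)
    have h1 : a ^ 2 < 1 := by nlinarith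
    have h2 : b ^ 2 < 1 := by nlinarith
    nlinarith [mul_nonneg (sq_nonneg a) (sub_nonneg.2 h2.le), sq_nonneg b]
  have hmean : 1 - (a ^ 2 + b ^ 2) ≤ (((1 + a) * (1 + b)) ^ β + ((1 - a) * (1 - b)) ^ β) / 2 := by
    rw [hsq _ hu, hsq _ hv]
    nlinarith [sq_nonneg (((1 + a) * (1 + b)) ^ (β / 2) - ((1 - a) * (1 - b)) ^ (β / 2)),
      mul_nonneg (sq_nonneg a) (sq_nonneg b)]
  rw [Real.mul_rpow ht.le hu.le, Real.mul_rpow ht.le hv.le]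
  nlinarith [mul_le_mul_of_nonneg_left hmean (Real.rpow_pos_of_pos ht β).le]

/-- Bernoulli bounds the mean of the `α`-th powers below by `1 + α a b ≥ 1 - (α/2)(a² + b²)`. The
factor `8/α` turns this loss into exactly `4 (a² + b²)`. -/
lemma rpow_sub_one_le {t a b α : ℝ} (ht : 0 < t) (ha : |a| < 1) (hb : |b| < 1) (hα : 1 ≤ α) :
    8 / α * (t ^ α - 1) ≤ (8 / α * ((t * ((1 + a) * (1 + b))) ^ α - 1) +
      8 / α * ((t * ((1 - a) * (1 - b))) ^ α - 1)) / 2 + t ^ α * (4 * (a ^ 2 + b ^ 2)) := by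
  obtain ⟨ha1, ha2⟩ := abs_lt.1 ha
  obtain ⟨hb1, hb2⟩ := abs_lt.1 hb
  have hu : 0 < (1 + a) * (1 + b) := mul_pos (by linarith) (by linarith)
  have hv : 0 < (1 - a) * (1 - b) := mul_pos (by linarith) (by linarith)
  have hα0 : 0 < α := by linarith
  have bern : ∀ u : ℝ, 0 < u → 1 + α * (u - 1) ≤ u ^ α := fun u h => by
    simpa using one_add_mul_self_le_rpow_one_add (s := u - 1) (by linarith) hα
  have hmean : 1 - α / 2 * (a ^ 2 + b ^ 2) ≤
      (((1 + a) * (1 + b)) ^ α + ((1 - a) * (1 - b)) ^ α) / 2 := by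
    have h1 := bern _ hu
    have h2 := bern _ hv
    nlinarith [mul_nonneg hα0.le (sq_nonneg (a + b))]
  rw [Real.mul_rpow ht.le hu.le, Real.mul_rpow ht.le hv.le]
  have h := mul_le_mul_of_nonneg_left hmean
    (mul_nonneg (div_pos (by norm_num : (0 : ℝ) < 8) hα0).le (Real.rpow_pos_of_pos ht α).le)
  have e : 8 / α * t ^ α * (1 - α / 2 * (a ^ 2 + b ^ 2)) =
      8 / α * t ^ α - t ^ α * (4 * (a ^ 2 + b ^ 2)) := by
    field_simp
    ring
  rw [e] at h
  linarith

/-- The mean of an affine function changes only through the term `t a b`, where `-2ab ≤ a² + b²`.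
The slope is admissible because `Q^(α-1) t ≤ t^α` for `t ≤ Q`. -/
lemma mul_sub_one_le {t a b α Q : ℝ} (ht : 0 < t) (htQ : t ≤ Q) (hα : α ≤ 1) :
    8 * Q ^ (α - 1) * (t - 1) ≤ (8 * Q ^ (α - 1) * (t * ((1 + a) * (1 + b)) - 1) +
      8 * Q ^ (α - 1) * (t * ((1 - a) * (1 - b)) - 1)) / 2 + t ^ α * (4 * (a ^ 2 + b ^ 2)) := by
  have hle : Q ^ (α - 1) * t ≤ t ^ α := by
    have h1 := Real.rpow_le_rpow_of_nonpos ht htQ (sub_nonpos.2 hα)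
    calc Q ^ (α - 1) * t ≤ t ^ (α - 1) * t := mul_le_mul_of_nonneg_right h1 ht.le
      _ = t ^ α := by rw [← Real.rpow_add_one ht.ne', sub_add_cancel]
  have h0 : 0 ≤ Q ^ (α - 1) * t :=
    mul_nonneg (Real.rpow_nonneg (ht.le.trans htQ) _) ht.le
  nlinarith [mul_le_mul_of_nonneg_right hle (by positivity : 0 ≤ a ^ 2 + b ^ 2),
    mul_nonneg h0 (sq_nonneg (a + b))]

end OneStep

/-! ### The Bellman argument and the bound `k_α(Q) ≤ ‖c‖` -/

section LowerBound

variable {D : DyadicLattice} {w : ℝ → ℝ}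

lemma cSeq_eq (hw : IsWeight w) (hv : IsWeight w⁻¹) (α : ℝ) (J : ℤ × ℤ) :
    cSeq D α w J = D.len J.1 * (localChar D w J ^ α *
      (avgDiff D w J ^ 2 / avg D w J ^ 2 + avgDiff D w⁻¹ J ^ 2 / avg D w⁻¹ J ^ 2)) := by
  rw [cSeq, localChar, Real.mul_rpow (hw.avg_pos D J).le (hv.avg_pos D J).le]
  ring

lemma localChar_pos (hw : IsWeight w) (hv : IsWeight w⁻¹) (J : ℤ × ℤ) : 0 < localChar D w J :=
  mul_pos (hw.avg_pos D J) (hv.avg_pos D J)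

lemma cSeq_nonneg (hw : IsWeight w) (hv : IsWeight w⁻¹) (α : ℝ) (J : ℤ × ℤ) :
    0 ≤ cSeq D α w J := by
  rw [cSeq_eq hw hv]
  have := D.len_pos J.1
  have := (localChar_pos (D := D) hw hv J).le
  positivity

/-- The relative half-differences of the averages over the two halves of an interval. -/
lemma exists_relative_halfDiff (hw : IsWeight w) (D : DyadicLattice) (J : ℤ × ℤ) :
    ∃ a : ℝ, |a| < 1 ∧ avg D w (leftHalf J) = avg D w J * (1 + a) ∧
      avg D w (rightHalf J) = avg D w J * (1 - a) ∧
      avgDiff D w J ^ 2 / avg D w J ^ 2 = 4 * a ^ 2 := by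
  have h := avg_eq_half (D := D) hw.1 J
  have hl := hw.avg_pos D (leftHalf J)
  have hr := hw.avg_pos D (rightHalf J)
  have hJ := hw.avg_pos D J
  have e : avg D w J * (avgDiff D w J / (2 * avg D w J)) = avgDiff D w J / 2 := by
    field_simp
  refine ⟨avgDiff D w J / (2 * avg D w J), ?_, ?_, ?_, ?_⟩
  · rw [abs_lt, lt_div_iff₀ (by positivity), div_lt_iff₀ (by positivity), avgDiff]
    constructor <;> linarith
  · rw [mul_add, e, avgDiff]
    linarith
  · rw [mul_sub, e, avgDiff]
    linarith
  · field_simp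
    ring

lemma exists_step (hw : IsWeight w) (hv : IsWeight w⁻¹) (D : DyadicLattice) (J : ℤ × ℤ) :
    ∃ a b : ℝ, |a| < 1 ∧ |b| < 1 ∧
      localChar D w (leftHalf J) = localChar D w J * ((1 + a) * (1 + b)) ∧
      localChar D w (rightHalf J) = localChar D w J * ((1 - a) * (1 - b)) ∧
      ∀ α, cSeq D α w J / D.len J.1 = localChar D w J ^ α * (4 * (a ^ 2 + b ^ 2)) := by
  obtain ⟨a, ha, h1, h2, h3⟩ := exists_relative_halfDiff hw D J
  obtain ⟨b, hb, h4, h5, h6⟩ := exists_relative_halfDiff hv D J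
  refine ⟨a, b, ha, hb, ?_, ?_, fun α => ?_⟩
  · rw [localChar, h1, h4, localChar]
    ring
  · rw [localChar, h2, h5, localChar]
    ring
  · rw [cSeq_eq hw hv, h3, h6, mul_div_cancel_left₀ _ (D.len_pos _).ne']
    ring

/-- The Bellman function argument. -/
lemma ofReal_le_carlesonAvg (hw : IsWeight w) (hv : IsWeight w⁻¹) {c : ℤ × ℤ → ℝ}
    (hc : ∀ J, 0 ≤ c J) {f : ℝ → ℝ} {K : ℝ} (hK : 0 ≤ K)
    (hstep : ∀ J, f (localChar D w J) ≤
      (f (localChar D w (leftHalf J)) + f (localChar D w (rightHalf J))) / 2 + c J / D.len J.1)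
    (hf : ∀ J, f (localChar D w J) ≤ K * (√(localChar D w J) - 1)) (I : ℤ × ℤ) :
    ENNReal.ofReal (f (localChar D w I)) ≤ carlesonAvg D c I := by
  have hl := D.len_pos I.1
  set S : ℕ → ℝ := fun n =>
    ∑ k ∈ Finset.range n, ∑ j ∈ Finset.range (2 ^ k), c (descendant I k j) with hS
  -- The one-step inequality iterated over `n` generations, multiplied by the number of descendants.
  have key : ∀ n : ℕ, 2 ^ n * f (localChar D w I) ≤
      ∑ j ∈ Finset.range (2 ^ n), f (localChar D w (descendant I n j)) +
        2 ^ n * (S n / D.len I.1) := by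
    intro n
    induction n with
    | zero => simp [descendant_zero, hS]
    | succ n ih =>
      have h1 : ∑ j ∈ Finset.range (2 ^ n), f (localChar D w (descendant I n j)) ≤
          (∑ j ∈ Finset.range (2 ^ (n + 1)), f (localChar D w (descendant I (n + 1) j))) / 2 +
            (∑ j ∈ Finset.range (2 ^ n), c (descendant I n j)) / D.len (I.1 + n) := by
        rw [pow_succ', sum_range_two_mul, Finset.sum_div, Finset.sum_div,
          ← Finset.sum_add_distrib]
        refine Finset.sum_le_sum fun j _ => ?_
        have := hstep (descendant I n j)
        rwa [leftHalf_descendant, rightHalf_descendant] at this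
      have h2 : S (n + 1) = S n + ∑ j ∈ Finset.range (2 ^ n), c (descendant I n j) :=
        Finset.sum_range_succ _ _
      have h3 : (∑ j ∈ Finset.range (2 ^ n), c (descendant I n j)) / D.len (I.1 + n) =
          2 ^ n * ((∑ j ∈ Finset.range (2 ^ n), c (descendant I n j)) / D.len I.1) := by
        have := D.len_pos (I.1 + n)
        rw [← D.len_add I.1 n]
        field_simp
      rw [h3] at h1
      rw [h2, add_div, pow_succ]
      linarith
  have hSle : ∀ n, ENNReal.ofReal (S n / D.len I.1) ≤ carlesonAvg D c I := by
    intro n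
    rw [carlesonAvg, D.tsum_ivl_subset (fun J => ENNReal.ofReal (c J)), D.volume_ivl,
      ENNReal.ofReal_div_of_pos hl]
    refine ENNReal.div_le_div_right ?_ _
    rw [hS, ENNReal.ofReal_sum_of_nonneg fun k _ => Finset.sum_nonneg fun j _ => hc _]
    simp_rw [ENNReal.ofReal_sum_of_nonneg fun j _ => hc _]
    exact ENNReal.sum_le_tsum _
  refine ENNReal.le_of_forall_pos_le_add fun ε hε _ => ?_
  -- Dividing by `K + 1` rather than `K` covers `K = 0`.
  obtain ⟨n, hn⟩ := exists_sum_sqrt_localChar_le hw hv D I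
    (ε := ε / (K + 1)) (div_pos (by exact_mod_cast hε) (by linarith))
  have h1 : ∑ j ∈ Finset.range (2 ^ n), f (localChar D w (descendant I n j)) ≤
      2 ^ n * (ε : ℝ) := by
    have hcard : ∑ _j ∈ Finset.range (2 ^ n), (1 : ℝ) = 2 ^ n := by simp
    calc _ ≤ ∑ j ∈ Finset.range (2 ^ n), K * (√(localChar D w (descendant I n j)) - 1) :=
          Finset.sum_le_sum fun j _ => hf _
      _ = K * (∑ j ∈ Finset.range (2 ^ n), √(localChar D w (descendant I n j)) - 2 ^ n) := by
          rw [← Finset.mul_sum, Finset.sum_sub_distrib, hcard]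
      _ ≤ K * (2 ^ n * (ε / (K + 1))) := mul_le_mul_of_nonneg_left (by linarith) hK
      _ = 2 ^ n * (ε * (K / (K + 1))) := by ring
      _ ≤ 2 ^ n * (ε * 1) := by
          have : K / (K + 1) ≤ 1 := (div_le_one (by linarith)).2 (by linarith)
          gcongr
      _ = _ := by ring
  have h2 : f (localChar D w I) ≤ S n / D.len I.1 + ε := by
    have : (0 : ℝ) < 2 ^ n := by positivity
    have h := key n
    refine le_of_mul_le_mul_left ?_ this
    linarith
  calc _ ≤ ENNReal.ofReal (S n / D.len I.1 + ε) := ENNReal.ofReal_le_ofReal h2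
    _ ≤ ENNReal.ofReal (S n / D.len I.1) + ENNReal.ofReal ε := ENNReal.ofReal_add_le
    _ ≤ _ := by
      rw [ENNReal.ofReal_coe_nnreal]
      gcongr
      exact hSle n

lemma sub_one_le_sqrt_sub_one {t Q : ℝ} (ht : 1 ≤ t) (htQ : t ≤ Q) :
    t - 1 ≤ (√Q + 1) * (√t - 1) := by
  have h1 : √t * √t = t := Real.mul_self_sqrt (by linarith)
  have h2 : 1 ≤ √t := Real.one_le_sqrt.2 ht
  have h3 : √t ≤ √Q := Real.sqrt_le_sqrt htQ
  nlinarith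

/-- Bernoulli at `1/t`, multiplied by `t^α`, gives `t^α - 1 ≤ α t^α (1 - 1/t)`. -/
lemma rpow_sub_one_le_mul {t Q α : ℝ} (ht : 1 ≤ t) (htQ : t ≤ Q) (hα : 1 ≤ α) :
    t ^ α - 1 ≤ α * Q ^ α * (t - 1) := by
  have ht0 : 0 < t := by linarith
  have h := one_add_mul_self_le_rpow_one_add (s := t⁻¹ - 1) (by have := inv_pos.2 ht0; linarith) hα
  rw [add_sub_cancel, Real.inv_rpow ht0.le] at h
  have hp : 0 < t ^ α := Real.rpow_pos_of_pos ht0 α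
  have hpQ : t ^ α ≤ Q ^ α := Real.rpow_le_rpow ht0.le htQ (by linarith)
  have h1 := mul_le_mul_of_nonneg_left h hp.le
  rw [mul_inv_cancel₀ hp.ne'] at h1
  have h2 : 1 - t⁻¹ ≤ t - 1 := by
    have : t * t⁻¹ = 1 := mul_inv_cancel₀ ht0.ne'
    nlinarith [inv_pos.2 ht0]
  have h3 : 0 ≤ 1 - t⁻¹ := sub_nonneg.2 (inv_le_one_of_one_le₀ ht)
  have h4 : t ^ α * (1 - t⁻¹) ≤ Q ^ α * (t - 1) := mul_le_mul hpQ h2 h3 (by linarith)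
  nlinarith

/-- A qualitative bound: the Carleson property for a positive exponent bounds the local
characteristics. -/
lemma localChar_rpow_le (hw : IsWeight w) (hv : IsWeight w⁻¹) {α C : ℝ}
    (hC0 : 0 ≤ C) (hC : ∀ I, carlesonAvg D (cSeq D α w) I ≤ ENNReal.ofReal C) (J : ℤ × ℤ) :
    localChar D w J ^ min α (1 / 2) ≤ 1 + C / 4 := by
  -- An exponent at most `α` keeps the step error below `c_J / |J|`, since `t ≥ 1`; an exponent at
  -- most `1/2` gives domination by `√t` with no a priori bound on `t`.
  have h := ofReal_le_carlesonAvg (D := D) hw hv (c := cSeq D α w) (cSeq_nonneg hw hv α)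
    (f := fun t => 4 * (t ^ min α (1 / 2) - 1)) (K := 4) (by norm_num) ?_ ?_ J
  · have := (ENNReal.ofReal_le_ofReal_iff hC0).1 (h.trans (hC J))
    linarith
  · intro J
    obtain ⟨a, b, ha, hb, h1, h2, h3⟩ := exists_step hw hv D J
    have ht := one_le_localChar hw hv D J
    rw [h1, h2, h3]
    refine (four_mul_rpow_sub_one_le (by linarith) ha hb
      ((min_le_right _ _).trans (by norm_num))).trans (add_le_add_right ?_ _)
    refine mul_le_mul_of_nonneg_right ?_ (by positivity)
    exact Real.rpow_le_rpow_of_exponent_le ht (min_le_left _ _)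
  · intro J
    have ht := one_le_localChar hw hv D J
    have : localChar D w J ^ min α (1 / 2) ≤ √(localChar D w J) := by
      rw [Real.sqrt_eq_rpow]
      exact Real.rpow_le_rpow_of_exponent_le ht (min_le_right _ _)
    linarith

lemma A2Char_le_ofReal {Q : ℝ} (h : ∀ J, localChar D w J ≤ Q) :
    A2Char D w ≤ ENNReal.ofReal Q :=
  iSup_le fun J => ENNReal.ofReal_le_ofReal (h J)

lemma ofReal_localChar_le_A2Char (J : ℤ × ℤ) : ENNReal.ofReal (localChar D w J) ≤ A2Char D w :=
  le_iSup (fun J : ℤ × ℤ => ENNReal.ofReal (avg D w J * avg D w⁻¹ J)) J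

/-- The lower bound for the Carleson constants in terms of the characteristic. -/
theorem kFun_A2Char_le (hw : IsWeight w) (hv : IsWeight w⁻¹) {α : ℝ} (hα : 0 < α) {C : ℝ}
    (hC0 : 0 ≤ C) (hC : ∀ I, carlesonAvg D (cSeq D α w) I ≤ ENNReal.ofReal C) :
    A2Char D w < ∞ ∧ 1 ≤ (A2Char D w).toReal ∧ kFun α (A2Char D w).toReal ≤ C := by
  -- Finiteness comes first: the constants `K` below, and for `α < 1` the Bellman function itself,
  -- depend on `Q`.
  have hfin : A2Char D w < ∞ := by
    have hβ : 0 < min α (1 / 2) := lt_min hα (by norm_num)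
    refine (A2Char_le_ofReal (Q := (1 + C / 4) ^ (min α (1 / 2))⁻¹) fun J => ?_).trans_lt
      ENNReal.ofReal_lt_top
    rw [Real.le_rpow_inv_iff_of_pos (localChar_pos hw hv J).le (by positivity) hβ]
    exact localChar_rpow_le hw hv hC0 hC J
  set Q := (A2Char D w).toReal with hQ
  have htQ : ∀ J, localChar D w J ≤ Q := fun J => by
    rw [hQ, ← ENNReal.ofReal_le_iff_le_toReal hfin.ne]
    exact ofReal_localChar_le_A2Char J
  have hQ1 : 1 ≤ Q := (one_le_localChar hw hv D (0, 0)).trans (htQ _)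
  have hQle : ∀ M, (∀ J, localChar D w J ≤ M) → Q ≤ M := fun M h =>
    ENNReal.toReal_le_of_le_ofReal ((localChar_pos hw hv (0, 0)).le.trans (h _))
      (A2Char_le_ofReal h)
  have hQ0 : 0 < Q := by linarith
  refine ⟨hfin, hQ1, ?_⟩
  rw [kFun]
  split_ifs with h1
  · have hle : ∀ J, 8 / α * (localChar D w J ^ α - 1) ≤ C := fun J => by
      refine (ENNReal.ofReal_le_ofReal_iff hC0).1 (le_trans ?_ (hC J))
      refine ofReal_le_carlesonAvg (D := D) hw hv (cSeq_nonneg hw hv α)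
        (f := fun t => 8 / α * (t ^ α - 1)) (K := 8 * Q ^ α * (√Q + 1)) (by positivity) ?_ ?_ J
      · intro J
        obtain ⟨a, b, ha, hb, e1, e2, e3⟩ := exists_step hw hv D J
        rw [e1, e2, e3]
        exact rpow_sub_one_le (localChar_pos hw hv J) ha hb h1
      · intro J
        have ht := one_le_localChar hw hv D J
        calc 8 / α * (localChar D w J ^ α - 1)
            ≤ 8 / α * (α * Q ^ α * (localChar D w J - 1)) :=
              mul_le_mul_of_nonneg_left (rpow_sub_one_le_mul ht (htQ J) h1) (by positivity)
          _ = 8 * Q ^ α * (localChar D w J - 1) := by field_simp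
          _ ≤ 8 * Q ^ α * ((√Q + 1) * (√(localChar D w J) - 1)) :=
              mul_le_mul_of_nonneg_left (sub_one_le_sqrt_sub_one ht (htQ J)) (by positivity)
          _ = _ := by ring
    -- Solving for `t_J` makes the bound uniform in `J`, so it passes to the supremum `Q`.
    have hM : Q ≤ (1 + α * C / 8) ^ α⁻¹ := hQle _ fun J => by
      rw [Real.le_rpow_inv_iff_of_pos (localChar_pos hw hv J).le (by positivity) hα]
      have := mul_le_mul_of_nonneg_left (hle J) (by positivity : 0 ≤ α / 8)
      have e : α / 8 * (8 / α * (localChar D w J ^ α - 1)) = localChar D w J ^ α - 1 := by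
        field_simp
      rw [e] at this
      linarith
    rw [Real.le_rpow_inv_iff_of_pos hQ0.le (by positivity) hα] at hM
    rw [div_mul_eq_mul_div, div_le_iff₀ hα]
    linarith
  · have h1' : α ≤ 1 := by linarith
    have hp : 0 < Q ^ (α - 1) := Real.rpow_pos_of_pos hQ0 _
    have hle : ∀ J, 8 * Q ^ (α - 1) * (localChar D w J - 1) ≤ C := fun J => by
      refine (ENNReal.ofReal_le_ofReal_iff hC0).1 (le_trans ?_ (hC J))
      refine ofReal_le_carlesonAvg (D := D) hw hv (cSeq_nonneg hw hv α)
        (f := fun t => 8 * Q ^ (α - 1) * (t - 1)) (K := 8 * Q ^ (α - 1) * (√Q + 1))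
        (by positivity) ?_ ?_ J
      · intro J
        obtain ⟨a, b, ha, hb, e1, e2, e3⟩ := exists_step hw hv D J
        rw [e1, e2, e3]
        exact mul_sub_one_le (localChar_pos hw hv J) (htQ J) h1'
      · intro J
        have ht := one_le_localChar hw hv D J
        calc 8 * Q ^ (α - 1) * (localChar D w J - 1)
            ≤ 8 * Q ^ (α - 1) * ((√Q + 1) * (√(localChar D w J) - 1)) :=
              mul_le_mul_of_nonneg_left (sub_one_le_sqrt_sub_one ht (htQ J)) (by positivity)
          _ = _ := by ring
    have hM : Q ≤ 1 + C / (8 * Q ^ (α - 1)) := hQle _ fun J => by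
      have : localChar D w J - 1 ≤ C / (8 * Q ^ (α - 1)) := by
        rw [le_div_iff₀ (by positivity)]
        linarith [hle J]
      linarith
    have h2 : (Q - 1) * (8 * Q ^ (α - 1)) ≤ C := by
      rw [← le_div_iff₀ (by positivity)]
      linarith
    have h3 : Q ^ α = Q ^ (α - 1) * Q := by rw [← Real.rpow_add_one hQ0.ne', sub_add_cancel]
    rw [h3]
    linarith

end LowerBound

/-! ### The function `k_α` and its inverse -/

section KFun

lemma kFun_one (α : ℝ) : kFun α 1 = 0 := by
  simp [kFun]

lemma strictMonoOn_kFun {α : ℝ} (hα : 0 < α) : StrictMonoOn (kFun α) (Ici 1) := by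
  intro x hx y hy hxy
  have hx0 : (0 : ℝ) < x := lt_of_lt_of_le one_pos hx
  have h : x ^ α < y ^ α := Real.rpow_lt_rpow hx0.le hxy hα
  simp only [kFun]
  split_ifs with h1
  · have := mul_lt_mul_of_pos_left h (div_pos (by norm_num : (0 : ℝ) < 8) hα)
    linarith
  · have := Real.rpow_le_rpow_of_nonpos (z := α - 1) hx0 hxy.le (by linarith)
    linarith

lemma continuousOn_kFun (α : ℝ) : ContinuousOn (kFun α) (Ici 1) := by
  have h : ∀ β : ℝ, ContinuousOn (fun x : ℝ => x ^ β) (Ici 1) := fun β =>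
    continuousOn_id.rpow_const fun x hx => Or.inl (lt_of_lt_of_le one_pos hx).ne'
  unfold kFun
  split_ifs
  · exact ((h α).sub continuousOn_const).const_mul _
  · exact ((h α).sub (h (α - 1))).const_mul _

lemma bijOn_kFun {α : ℝ} (hα : 0 < α) : BijOn (kFun α) (Ici 1) (Ici 0) := by
  refine ⟨fun x hx => ?_, (strictMonoOn_kFun hα).injOn, fun B hB => ?_⟩
  · rw [mem_Ici, ← kFun_one α]
    exact (strictMonoOn_kFun hα).monotoneOn self_mem_Ici hx hx
  · have hB : 0 ≤ B := hB
    have hbase : (1 : ℝ) ≤ 1 + (α + 1) * B := by nlinarith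
    -- At this point `Q^α - 1 = (α + 1) B`, large enough for `k_α(Q) ≥ B` in both cases; for `α < 1`
    -- also `Q^(α-1) ≤ 1`.
    have hQ1 : 1 ≤ (1 + (α + 1) * B) ^ α⁻¹ := Real.one_le_rpow hbase (by positivity)
    have hQ : ((1 + (α + 1) * B) ^ α⁻¹) ^ α = 1 + (α + 1) * B :=
      Real.rpow_inv_rpow (by linarith) hα.ne'
    have hBle : B ≤ kFun α ((1 + (α + 1) * B) ^ α⁻¹) := by
      rw [kFun]
      split_ifs with h1
      · rw [hQ, div_mul_eq_mul_div, le_div_iff₀ hα]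
        nlinarith
      · have := Real.rpow_le_one_of_one_le_of_nonpos (z := α - 1) hQ1 (by linarith)
        rw [hQ]
        nlinarith
    obtain ⟨q, hq, hqB⟩ := intermediate_value_Icc hQ1
      ((continuousOn_kFun α).mono Icc_subset_Ici_self) ⟨(kFun_one α).trans_le hB, hBle⟩
    exact ⟨q, hq.1, hqB⟩

lemma kInv_mem {α : ℝ} (hα : 0 < α) {B : ℝ} (hB : 0 ≤ B) : 1 ≤ kInv α B :=
  Function.invFunOn_mem ((bijOn_kFun hα).surjOn hB)

lemma kFun_kInv {α : ℝ} (hα : 0 < α) {B : ℝ} (hB : 0 ≤ B) : kFun α (kInv α B) = B :=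
  Function.invFunOn_eq ((bijOn_kFun hα).surjOn hB)

lemma le_kInv {α : ℝ} (hα : 0 < α) {B Q : ℝ} (hB : 0 ≤ B) (hQ : 1 ≤ Q) (h : kFun α Q ≤ B) :
    Q ≤ kInv α B := by
  rw [← (strictMonoOn_kFun hα).le_iff_le hQ (kInv_mem hα hB), kFun_kInv hα hB]
  exact h

end KFun

/-! ### Computing Carleson norms -/

section Carleson

variable {D : DyadicLattice} {w : ℝ → ℝ}

lemma carlesonNorm_eq_iSup (D : DyadicLattice) (c : ℤ × ℤ → ℝ) :
    carlesonNorm D c = ⨆ I, carlesonAvg D c I :=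
  le_antisymm (sInf_le fun I => le_iSup (carlesonAvg D c) I)
    (le_sInf fun _ hC => iSup_le hC)

lemma isCarleson_iff {c : ℤ × ℤ → ℝ} :
    IsCarleson D c ↔ (∀ J, 0 ≤ c J) ∧ carlesonNorm D c < ∞ := by
  rw [carlesonNorm_eq_iSup]
  refine and_congr_right fun _ => ⟨?_, fun h => ⟨_, h, le_iSup _⟩⟩
  rintro ⟨C, hC, h⟩
  exact (iSup_le h).trans_lt hC

/-- The Carleson averages of a sequence that is bounded on every level. -/
lemma carlesonAvg_le_tsum {c : ℤ × ℤ → ℝ} {I : ℤ × ℤ} {d : ℕ → ℝ≥0∞}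
    (h : ∀ k, ∑ j ∈ Finset.range (2 ^ k), ENNReal.ofReal (c (descendant I k j)) ≤
      ENNReal.ofReal (D.len I.1) * d k) :
    carlesonAvg D c I ≤ ∑' k, d k := by
  rw [carlesonAvg, D.tsum_ivl_subset (fun J => ENNReal.ofReal (c J)), D.volume_ivl]
  refine ENNReal.div_le_of_le_mul' ?_
  rw [← ENNReal.tsum_mul_left]
  exact ENNReal.tsum_le_tsum h

/-- The Carleson averages of a sequence that is constant on every generation. -/
lemma carlesonAvg_of_generation {c : ℤ × ℤ → ℝ} {d : ℤ → ℝ}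
    (hc : ∀ J, c J = D.len J.1 * d J.1) (I : ℤ × ℤ) :
    carlesonAvg D c I = ∑' k : ℕ, ENNReal.ofReal (d (I.1 + k)) := by
  have hl := D.len_pos I.1
  rw [carlesonAvg, D.tsum_ivl_subset (fun J => ENNReal.ofReal (c J)), D.volume_ivl,
    div_eq_mul_inv, ← ENNReal.tsum_mul_right]
  refine tsum_congr fun k => ?_
  have h : ∀ j, ENNReal.ofReal (c (descendant I k j)) =
      ENNReal.ofReal (D.len (I.1 + k) * d (I.1 + k)) := fun j => by rw [hc]; rfl
  have e : ((2 ^ k : ℕ) : ℝ≥0∞) = ENNReal.ofReal (2 ^ k) := by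
    rw [ENNReal.ofReal_pow (by norm_num)]
    simp
  simp only [h, Finset.sum_const, Finset.card_range, nsmul_eq_mul]
  rw [e, ← ENNReal.ofReal_mul (by positivity), ← mul_assoc, D.len_add,
    ENNReal.ofReal_mul hl.le, mul_comm, ← mul_assoc, ENNReal.inv_mul_cancel, one_mul]
  · simpa using hl
  · exact ENNReal.ofReal_ne_top

/-- The Carleson average over `I` is the sum of `d` from the generation of `I` on. An interval of
generation `0` already sees the whole support of `d`, so it attains the supremum. -/
lemma carlesonNorm_of_generation {c : ℤ × ℤ → ℝ} {d : ℤ → ℝ} (hd : ∀ n, 0 ≤ d n)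
    (hc : ∀ J, c J = D.len J.1 * d J.1) {N : ℕ} (hN : ∀ n : ℤ, n < 0 ∨ N ≤ n → d n = 0) :
    carlesonNorm D c = ENNReal.ofReal (∑ i ∈ Finset.range N, d (i : ℤ)) := by
  have hsum : ∑' k : ℕ, ENNReal.ofReal (d k) = ENNReal.ofReal (∑ i ∈ Finset.range N, d (i : ℤ)) := by
    rw [ENNReal.ofReal_sum_of_nonneg fun i _ => hd _]
    refine tsum_eq_sum fun k hk => ?_
    rw [hN k (Or.inr (by simpa using hk)), ENNReal.ofReal_zero]
  rw [carlesonNorm_eq_iSup, ← hsum]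
  refine le_antisymm (iSup_le fun I => ?_) (le_iSup_of_le (0, 0) ?_)
  · rw [carlesonAvg_of_generation hc]
    have h1 : ∑' k : ℕ, ENNReal.ofReal (d (I.1 + k)) ≤ ∑' n : ℤ, ENNReal.ofReal (d n) :=
      ENNReal.tsum_comp_le_tsum_of_injective (f := fun k : ℕ => I.1 + k)
        (fun a b h => by simpa using h) (fun n => ENNReal.ofReal (d n))
    refine h1.trans (le_of_eq ?_)
    refine (Function.Injective.tsum_eq Nat.cast_injective fun n hn => ?_).symm
    have : 0 ≤ n := by
      by_contra! h
      exact hn (by simp [hN n (Or.inl h)])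
    exact ⟨n.toNat, Int.toNat_of_nonneg this⟩
  · rw [carlesonAvg_of_generation hc]
    simp

lemma ivl_leftHalf_subset (D : DyadicLattice) (J : ℤ × ℤ) : D.ivl (leftHalf J) ⊆ D.ivl J :=
  D.ivl_subset_iff.2 ⟨1, 0, by simp, by simp [leftHalf, descendant]⟩

lemma ivl_rightHalf_subset (D : DyadicLattice) (J : ℤ × ℤ) : D.ivl (rightHalf J) ⊆ D.ivl J :=
  D.ivl_subset_iff.2 ⟨1, 1, by simp, by simp [rightHalf, descendant]⟩

lemma avgDiff_of_eqOn {c : ℝ} {J : ℤ × ℤ} (h : ∀ x ∈ D.ivl J, w x = c) : avgDiff D w J = 0 := by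
  rw [avgDiff, avg_of_eqOn fun x hx => h x (ivl_leftHalf_subset D J hx),
    avg_of_eqOn fun x hx => h x (ivl_rightHalf_subset D J hx), sub_self]

lemma cSeq_of_eqOn {c : ℝ} {J : ℤ × ℤ} (α : ℝ) (h : ∀ x ∈ D.ivl J, w x = c) :
    cSeq D α w J = 0 := by
  have h' : ∀ x ∈ D.ivl J, w⁻¹ x = c⁻¹ := fun x hx => by rw [Pi.inv_apply, h x hx]
  simp [cSeq, avgDiff_of_eqOn h, avgDiff_of_eqOn h']

lemma localChar_of_eqOn {c : ℝ} (hc : c ≠ 0) {J : ℤ × ℤ} (h : ∀ x ∈ D.ivl J, w x = c) :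
    localChar D w J = 1 := by
  have h' : ∀ x ∈ D.ivl J, w⁻¹ x = c⁻¹ := fun x hx => by rw [Pi.inv_apply, h x hx]
  rw [localChar, avg_of_eqOn h, avg_of_eqOn h', mul_inv_cancel₀ hc]

lemma avg_const_mul (c : ℝ) (J : ℤ × ℤ) : avg D (fun x => c * w x) J = c * avg D w J := by
  rw [avg_eq, avg_eq, integral_const_mul]
  ring

end Carleson

/-! ### Riesz products as extremal weights -/

section Riesz

/-- The values on the intervals of generation `n` of the Riesz product `∏_{j < n} (1 + ε r_j)` of
Rademacher functions. -/
def rieszProd (ε : ℝ) : ℕ → ℤ → ℝ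
  | 0, _ => 1
  | n + 1, m => rieszProd ε n (m / 2) * if Even m then 1 + ε else 1 - ε

/-- The Riesz product of the first `N` Rademacher functions of the lattice. -/
def rieszWeight (D : DyadicLattice) (ε : ℝ) (N : ℕ) (x : ℝ) : ℝ := rieszProd ε N (D.idx N x)

variable {D : DyadicLattice} {ε : ℝ}

lemma rieszProd_two_mul (n : ℕ) (m : ℤ) :
    rieszProd ε (n + 1) (2 * m) = rieszProd ε n m * (1 + ε) := by
  simp [rieszProd]

lemma rieszProd_two_mul_add_one (n : ℕ) (m : ℤ) :
    rieszProd ε (n + 1) (2 * m + 1) = rieszProd ε n m * (1 - ε) := by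
  have h1 : (2 * m + 1) / 2 = m := by omega
  have h2 : ¬ Even (2 * m + 1) := by simp
  simp [rieszProd, h1, h2]

lemma rieszProd_pos (hε : |ε| < 1) (n : ℕ) (m : ℤ) : 0 < rieszProd ε n m := by
  obtain ⟨h1, h2⟩ := abs_lt.1 hε
  induction n generalizing m with
  | zero => exact one_pos
  | succ n ih =>
    refine mul_pos (ih _) ?_
    split_ifs <;> linarith

lemma rieszProd_le (hε : |ε| < 1) (n : ℕ) (m : ℤ) : rieszProd ε n m ≤ 2 ^ n := by
  obtain ⟨h1, h2⟩ := abs_lt.1 hε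
  induction n generalizing m with
  | zero => simp [rieszProd]
  | succ n ih =>
    rw [pow_succ]
    refine mul_le_mul (ih _) ?_ ?_ (by positivity) <;> split_ifs <;> linarith

/-- Each pair of factors is `(1 + ε)(1 - ε)`. Hence the reciprocal weight is a constant multiple of
the Riesz product for `-ε`. -/
lemma rieszProd_mul_neg (n : ℕ) (m : ℤ) :
    rieszProd ε n m * rieszProd (-ε) n m = (1 - ε ^ 2) ^ n := by
  induction n generalizing m with
  | zero => simp [rieszProd]
  | succ n ih =>
    rw [pow_succ, ← ih (m / 2)]
    simp only [rieszProd]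
    split_ifs <;> ring

lemma isWeight_rieszWeight (hε : |ε| < 1) (N : ℕ) : IsWeight (rieszWeight D ε N) := by
  refine ⟨(locallyIntegrable_const ((2 : ℝ) ^ N)).mono ?_ ?_,
    Eventually.of_forall fun x => rieszProd_pos hε _ _⟩
  · have : Measurable (rieszProd ε N) := measurable_of_countable _
    exact (this.comp (D.measurable_idx N)).aestronglyMeasurable
  · refine Eventually.of_forall fun x => ?_
    rw [rieszWeight, Real.norm_of_nonneg (rieszProd_pos hε _ _).le, Real.norm_of_nonneg (by positivity)]
    exact rieszProd_le hε _ _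

lemma inv_rieszWeight (hε : |ε| < 1) (N : ℕ) :
    (rieszWeight D ε N)⁻¹ = fun x => ((1 - ε ^ 2) ^ N)⁻¹ * rieszWeight D (-ε) N x := by
  have hε' : |-ε| < 1 := by rwa [abs_neg]
  ext x
  have h1 := rieszProd_pos hε N (D.idx N x)
  have h2 := rieszProd_pos hε' N (D.idx N x)
  rw [Pi.inv_apply, rieszWeight, rieszWeight, ← rieszProd_mul_neg N (D.idx N x)]
  field_simp

lemma isWeight_inv_rieszWeight (hε : |ε| < 1) (N : ℕ) : IsWeight (rieszWeight D ε N)⁻¹ := by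
  have hε' : |-ε| < 1 := by rwa [abs_neg]
  constructor
  · rw [inv_rieszWeight hε]
    exact (isWeight_rieszWeight hε' N).1.smul (((1 - ε ^ 2) ^ N)⁻¹)
  · exact Eventually.of_forall fun x => inv_pos.2 (rieszProd_pos hε _ _)

/-- The partial products form a martingale. `Int.toNat` sends negative generations to the empty
product `1`. -/
lemma avg_rieszWeight (hε : |ε| < 1) (N : ℕ) {n : ℤ} (hn : n ≤ N) (m : ℤ) :
    avg D (rieszWeight D ε N) (n, m) = rieszProd ε n.toNat m := by
  induction n, hn using Int.leInductionDown generalizing m with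
  | base =>
    refine avg_of_eqOn fun x hx => ?_
    rw [rieszWeight, D.mem_ivl_iff.1 hx]
    rfl
  | pred n hn ih =>
    rw [avg_eq_half (isWeight_rieszWeight hε N).1, leftHalf, rightHalf]
    simp only [sub_add_cancel]
    rw [ih, ih]
    rcases le_or_gt n 0 with h | h
    · rw [Int.toNat_of_nonpos h, Int.toNat_of_nonpos (by omega)]
      simp [rieszProd]
    · obtain ⟨k, rfl⟩ : ∃ k : ℕ, n = k + 1 := ⟨(n - 1).toNat, by omega⟩
      have e1 : ((k : ℤ) + 1).toNat = k + 1 := by omega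
      have e2 : ((k : ℤ) + 1 - 1).toNat = k := by omega
      rw [e1, e2, rieszProd_two_mul, rieszProd_two_mul_add_one]
      ring

lemma avg_inv_rieszWeight (hε : |ε| < 1) (N : ℕ) {n : ℤ} (hn : n ≤ N) (m : ℤ) :
    avg D (rieszWeight D ε N)⁻¹ (n, m) =
      ((1 - ε ^ 2) ^ N)⁻¹ * rieszProd (-ε) n.toNat m := by
  rw [inv_rieszWeight hε, avg_const_mul, avg_rieszWeight (by rwa [abs_neg]) N hn]

lemma exists_rieszWeight_eqOn (hε : |ε| < 1) (N : ℕ) {J : ℤ × ℤ} (hJ : N ≤ J.1) :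
    ∃ c ≠ 0, ∀ x ∈ D.ivl J, rieszWeight D ε N x = c := by
  obtain ⟨k, hk⟩ := Int.le.dest hJ
  refine ⟨rieszProd ε N (J.2 / 2 ^ k), (rieszProd_pos hε _ _).ne', fun x hx => ?_⟩
  rw [rieszWeight, D.idx_add N k x, hk, D.mem_ivl_iff.1 hx]

lemma localChar_rieszWeight (hε : |ε| < 1) (N : ℕ) {n : ℤ} (hn : n ≤ N) (m : ℤ) :
    localChar D (rieszWeight D ε N) (n, m) = (1 - ε ^ 2)⁻¹ ^ (N - n.toNat) := by
  have hs : 0 < 1 - ε ^ 2 := by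
    rw [sub_pos, sq_lt_one_iff_abs_lt_one]
    exact hε
  have h : n.toNat ≤ N := by omega
  rw [localChar, avg_rieszWeight hε N hn, avg_inv_rieszWeight hε N hn, mul_left_comm,
    rieszProd_mul_neg, inv_pow, ← Nat.sub_add_cancel h, pow_add, Nat.add_sub_cancel]
  field_simp

lemma avgDiff_rieszWeight (hε : |ε| < 1) (N : ℕ) {n : ℕ} (hn : n < N) (m : ℤ) :
    avgDiff D (rieszWeight D ε N) (n, m) = rieszProd ε n m * (2 * ε) := by
  have h : (n : ℤ) + 1 ≤ N := by omega
  have e : ((n : ℤ) + 1).toNat = n + 1 := by omega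
  rw [avgDiff, leftHalf, rightHalf, avg_rieszWeight hε N h, avg_rieszWeight hε N h, e,
    rieszProd_two_mul, rieszProd_two_mul_add_one]
  ring

lemma avgDiff_const_mul (c : ℝ) (w : ℝ → ℝ) (J : ℤ × ℤ) :
    avgDiff D (fun x => c * w x) J = c * avgDiff D w J := by
  rw [avgDiff, avgDiff, avg_const_mul, avg_const_mul]
  ring

lemma avgDiff_rieszWeight_of_neg (hε : |ε| < 1) (N : ℕ) {n : ℤ} (hn : n < 0) (m : ℤ) :
    avgDiff D (rieszWeight D ε N) (n, m) = 0 := by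
  have h : n + 1 ≤ N := by omega
  rw [avgDiff, leftHalf, rightHalf, avg_rieszWeight hε N h, avg_rieszWeight hε N h,
    Int.toNat_of_nonpos (by omega)]
  simp [rieszProd]

/-- The value of `c_J^{(α)} / |J|` for the Riesz product, on generation `n`. -/
def rieszCoeff (α ε : ℝ) (N : ℕ) (n : ℤ) : ℝ :=
  if 0 ≤ n ∧ n < N then 8 * ε ^ 2 * ((1 - ε ^ 2)⁻¹ ^ (N - n.toNat)) ^ α else 0

lemma cSeq_rieszWeight (hε : |ε| < 1) (N : ℕ) (α : ℝ) (J : ℤ × ℤ) :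
    cSeq D α (rieszWeight D ε N) J = D.len J.1 * rieszCoeff α ε N J.1 := by
  have hε' : |-ε| < 1 := by rwa [abs_neg]
  have hs : 0 < 1 - ε ^ 2 := by
    rw [sub_pos, sq_lt_one_iff_abs_lt_one]
    exact hε
  obtain ⟨n, m⟩ := J
  rw [rieszCoeff]
  split_ifs with h
  · obtain ⟨h0, hN⟩ := h
    lift n to ℕ using h0
    have hnN : n < N := Int.ofNat_lt.1 hN
    rw [cSeq_eq (isWeight_rieszWeight hε N) (isWeight_inv_rieszWeight hε N),
      localChar_rieszWeight hε N hN.le, avgDiff_rieszWeight hε N hnN,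
      avg_rieszWeight hε N hN.le, avg_inv_rieszWeight hε N hN.le, inv_rieszWeight hε,
      avgDiff_const_mul, avgDiff_rieszWeight hε' N hnN]
    have h1 := rieszProd_pos hε n m
    have h2 := rieszProd_pos hε' n m
    simp only [Int.toNat_natCast]
    field_simp
    ring
  · rw [mul_zero]
    rcases lt_or_ge n 0 with h0 | h0
    · rw [cSeq, avgDiff_rieszWeight_of_neg hε N h0, inv_rieszWeight hε, avgDiff_const_mul,
        avgDiff_rieszWeight_of_neg hε' N h0]
      simp
    · obtain ⟨c, -, hc⟩ := exists_rieszWeight_eqOn (D := D) hε N (J := (n, m))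
        (not_lt.1 fun hN => h ⟨h0, hN⟩)
      exact cSeq_of_eqOn α hc

lemma A2Char_rieszWeight (hε : |ε| < 1) (N : ℕ) :
    A2Char D (rieszWeight D ε N) = ENNReal.ofReal ((1 - ε ^ 2)⁻¹ ^ N) := by
  have hs : 0 < 1 - ε ^ 2 := by
    rw [sub_pos, sq_lt_one_iff_abs_lt_one]
    exact hε
  have hr : 1 ≤ (1 - ε ^ 2)⁻¹ := (one_le_inv₀ hs).2 (by nlinarith [sq_nonneg ε])
  refine le_antisymm (A2Char_le_ofReal fun J => ?_) ?_
  · rcases le_total J.1 N with h | h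
    · rw [show J = (J.1, J.2) from rfl, localChar_rieszWeight hε N h]
      exact pow_le_pow_right₀ hr (Nat.sub_le _ _)
    · obtain ⟨c, hc0, hc⟩ := exists_rieszWeight_eqOn (D := D) hε N h
      rw [localChar_of_eqOn hc0 hc]
      exact one_le_pow₀ hr
  · have := ofReal_localChar_le_A2Char (D := D) (w := rieszWeight D ε N) (0, 0)
    rwa [localChar_rieszWeight hε N (by omega), Int.toNat_zero, Nat.sub_zero] at this

/-- The Carleson norm of `c^{(α)}` for the Riesz product of length `N` with characteristic
`r ^ N`. -/
def rieszNorm (α : ℝ) (N : ℕ) (r : ℝ) : ℝ :=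
  ∑ i ∈ Finset.range N, 8 * (1 - r⁻¹) * (r ^ (i + 1)) ^ α

lemma rieszNorm_nonneg (α : ℝ) (N : ℕ) {r : ℝ} (hr : 1 ≤ r) : 0 ≤ rieszNorm α N r := by
  have h : 0 ≤ 1 - r⁻¹ := sub_nonneg.2 (inv_le_one_of_one_le₀ hr)
  exact Finset.sum_nonneg fun i _ => by positivity

theorem exists_weight_rieszNorm (D : DyadicLattice) (α : ℝ) (N : ℕ) {r : ℝ} (hr : 1 ≤ r) :
    ∃ w : ℝ → ℝ, IsWeight w ∧ IsWeight w⁻¹ ∧ IsCarleson D (cSeq D α w) ∧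
      carlesonNorm D (cSeq D α w) = ENNReal.ofReal (rieszNorm α N r) ∧
      A2Char D w = ENNReal.ofReal (r ^ N) := by
  have h0 : 0 ≤ 1 - r⁻¹ := sub_nonneg.2 (inv_le_one_of_one_le₀ hr)
  -- The choice `ε = √(1 - r⁻¹)` makes each step multiply the characteristic by `(1 - ε²)⁻¹ = r`.
  have hsq : √(1 - r⁻¹) ^ 2 = 1 - r⁻¹ := Real.sq_sqrt h0
  have hinv : (1 - √(1 - r⁻¹) ^ 2)⁻¹ = r := by rw [hsq, sub_sub_cancel, inv_inv]
  have hε : |√(1 - r⁻¹)| < 1 := by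
    rw [← sq_lt_one_iff_abs_lt_one, hsq]
    have := inv_pos.2 (zero_lt_one.trans_le hr)
    linarith
  have hw := isWeight_rieszWeight (D := D) hε N
  have hv := isWeight_inv_rieszWeight (D := D) hε N
  have hnorm : carlesonNorm D (cSeq D α (rieszWeight D √(1 - r⁻¹) N)) =
      ENNReal.ofReal (rieszNorm α N r) := by
    rw [carlesonNorm_of_generation (d := rieszCoeff α √(1 - r⁻¹) N) (N := N) ?_
      (cSeq_rieszWeight hε N α) ?_]
    · congr 1
      -- Generation `n` carries the power `r^(N - n)`, so the summation order is reversed.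
      rw [rieszNorm, ← Finset.sum_range_reflect]
      refine Finset.sum_congr rfl fun i hi => ?_
      have hi := Finset.mem_range.1 hi
      rw [rieszCoeff, if_pos ⟨by omega, by omega⟩, hsq, sub_sub_cancel, inv_inv]
      congr 3
      omega
    · intro n
      rw [rieszCoeff, hinv]
      split_ifs <;> positivity
    · intro n hn
      rw [rieszCoeff, if_neg (by omega)]
  refine ⟨_, hw, hv, isCarleson_iff.2 ⟨cSeq_nonneg hw hv α, ?_⟩, hnorm, ?_⟩
  · rw [hnorm]
    exact ENNReal.ofReal_lt_top
  · rw [A2Char_rieszWeight hε, hinv]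

end Riesz

/-! ### Riesz products nearly attain `k_α` -/

section Sharpness

variable {α : ℝ}

/-- A geometric sum of ratio `r^α`, with `α (r - 1) ≤ r^α - 1` by Bernoulli. The excess factor
`r^(α-1)` tends to `1` when `r = Q^(1/N)` and `N → ∞`. -/
lemma rieszNorm_le (hα : 1 ≤ α) (N : ℕ) {r : ℝ} (hr : 1 ≤ r) :
    rieszNorm α N r ≤ 8 / α * ((r ^ N) ^ α - 1) * r ^ (α - 1) := by
  have hr0 : 0 < r := by linarith
  have hα0 : 0 < α := by linarith
  have hbern : α * (r - 1) ≤ r ^ α - 1 := by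
    have := one_add_mul_self_le_rpow_one_add (s := r - 1) (by linarith) hα
    rw [add_sub_cancel] at this
    linarith
  have hG : 0 ≤ ∑ i ∈ Finset.range N, (r ^ α) ^ i := Finset.sum_nonneg fun i _ => by positivity
  have hgeom := geom_sum_mul (r ^ α) N
  have hp : 0 < r ^ (α - 1) := Real.rpow_pos_of_pos hr0 _
  have hmul : r ^ α = r ^ (α - 1) * r := by rw [← Real.rpow_add_one hr0.ne', sub_add_cancel]
  have e : rieszNorm α N r = 8 * r ^ (α - 1) * ((r - 1) * ∑ i ∈ Finset.range N, (r ^ α) ^ i) := by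
    rw [rieszNorm, Finset.mul_sum, Finset.mul_sum]
    refine Finset.sum_congr rfl fun i _ => ?_
    rw [← Real.rpow_pow_comm hr0.le, pow_succ, mul_comm ((r ^ α) ^ i) (r ^ α)]
    nth_rewrite 1 [hmul]
    field_simp
  have h1 : (r - 1) * ∑ i ∈ Finset.range N, (r ^ α) ^ i ≤ ((r ^ N) ^ α - 1) / α := by
    rw [le_div_iff₀ hα0, ← Real.rpow_pow_comm hr0.le, ← hgeom]
    nlinarith [mul_le_mul_of_nonneg_right hbern hG]
  calc _ = _ := e
    _ ≤ 8 * r ^ (α - 1) * (((r ^ N) ^ α - 1) / α) :=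
        mul_le_mul_of_nonneg_left h1 (by positivity)
    _ = _ := by ring

lemma exists_rieszNorm_lt {Q δ : ℝ} (hQ : 1 ≤ Q) (hδ : kFun α Q < δ) :
    ∃ N : ℕ, N ≠ 0 ∧ rieszNorm α N (Q ^ (N : ℝ)⁻¹) < δ := by
  have hQ0 : 0 < Q := by linarith
  rcases le_or_gt 1 α with h1 | h1
  · have hlim : Tendsto (fun N : ℕ => 8 / α * (Q ^ α - 1) * (Q ^ (N : ℝ)⁻¹) ^ (α - 1)) atTop
        (𝓝 (8 / α * (Q ^ α - 1) * (Q ^ (0 : ℝ)) ^ (α - 1))) := by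
      refine Tendsto.const_mul _ (Tendsto.rpow_const ?_ (Or.inr (by linarith)))
      exact (Real.continuousAt_const_rpow hQ0.ne').tendsto.comp tendsto_inv_atTop_nhds_zero_nat
    rw [Real.rpow_zero, Real.one_rpow, mul_one] at hlim
    rw [kFun, if_pos h1] at hδ
    obtain ⟨N, hN, hN0⟩ := ((hlim.eventually_lt_const hδ).and (eventually_ne_atTop 0)).exists
    refine ⟨N, hN0, lt_of_le_of_lt ?_ hN⟩
    have := rieszNorm_le h1 N (Real.one_le_rpow hQ (inv_nonneg.2 N.cast_nonneg))
    rwa [Real.rpow_inv_natCast_pow hQ0.le hN0] at this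
  · refine ⟨1, one_ne_zero, ?_⟩
    rw [kFun, if_neg h1.not_ge, Real.rpow_sub_one hQ0.ne'] at hδ
    refine lt_of_eq_of_lt ?_ hδ
    simp only [rieszNorm, Nat.cast_one, inv_one, Real.rpow_one, Finset.sum_range_one, zero_add,
      pow_one]
    ring

lemma continuousOn_rieszNorm (hα : 0 < α) (N : ℕ) : ContinuousOn (rieszNorm α N) (Ici 1) := by
  have h0 : ∀ r ∈ Ici (1 : ℝ), r ≠ 0 := fun r hr => (lt_of_lt_of_le one_pos hr).ne'
  unfold rieszNorm
  refine continuousOn_finsetSum _ fun i _ => ContinuousOn.mul ?_ ?_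
  · exact (continuousOn_const.sub (continuousOn_id.inv₀ h0)).const_mul _
  · exact (continuousOn_id.pow _).rpow_const fun r _ => Or.inr hα.le

/-- The general lower bound applied to the Riesz product itself, on an arbitrarily chosen lattice.
-/
lemma kFun_pow_le_rieszNorm (hα : 0 < α) (N : ℕ) {r : ℝ} (hr : 1 ≤ r) :
    kFun α (r ^ N) ≤ rieszNorm α N r := by
  obtain ⟨w, hw, hv, -, hnorm, hchar⟩ := exists_weight_rieszNorm ⟨0, 1, one_pos⟩ α N hr
  rw [carlesonNorm_eq_iSup] at hnorm
  have h := (kFun_A2Char_le hw hv hα (rieszNorm_nonneg α N hr)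
    fun I => (le_iSup _ I).trans_eq hnorm).2.2
  rwa [hchar, ENNReal.toReal_ofReal (by positivity)] at h

/-- Every Carleson norm is attained by a weight whose characteristic is nearly maximal. -/
lemma exists_rieszNorm_eq (hα : 0 < α) {B Q : ℝ} (hB : 0 ≤ B) (hQ : 1 ≤ Q) (hQB : Q < kInv α B) :
    ∃ (N : ℕ) (r : ℝ), 1 ≤ r ∧ rieszNorm α N r = B ∧ Q ≤ r ^ N := by
  have hQ0 : 0 < Q := by linarith
  have hK := kInv_mem hα hB
  have hlt : kFun α Q < B := by
    rw [← kFun_kInv hα hB]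
    exact strictMonoOn_kFun hα hQ hK hQB
  obtain ⟨N, hN0, hN⟩ := exists_rieszNorm_lt hQ hlt
  have hNi : 0 ≤ (N : ℝ)⁻¹ := inv_nonneg.2 N.cast_nonneg
  have h1 : 1 ≤ Q ^ (N : ℝ)⁻¹ := Real.one_le_rpow hQ hNi
  have h2 : Q ^ (N : ℝ)⁻¹ ≤ kInv α B ^ (N : ℝ)⁻¹ := Real.rpow_le_rpow hQ0.le hQB.le hNi
  have h3 : B ≤ rieszNorm α N (kInv α B ^ (N : ℝ)⁻¹) := by
    have := kFun_pow_le_rieszNorm hα N (h1.trans h2)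
    rwa [Real.rpow_inv_natCast_pow (by linarith) hN0, kFun_kInv hα hB] at this
  -- With `N` fixed, the norm is below `B` at `r = Q^(1/N)` and at least `B` at `r =
  -- k_α⁻¹(B)^(1/N)`.
  obtain ⟨r, hr, hrB⟩ := intermediate_value_Icc h2
    ((continuousOn_rieszNorm hα N).mono fun x hx => h1.trans hx.1) ⟨hN.le, h3⟩
  refine ⟨N, r, h1.trans hr.1, hrB, ?_⟩
  calc Q = (Q ^ (N : ℝ)⁻¹) ^ N := (Real.rpow_inv_natCast_pow hQ0.le hN0).symm
    _ ≤ r ^ N := pow_le_pow_left₀ (by linarith) hr.1 N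

end Sharpness

/-! ### The sharp estimate -/

section Estimate

variable {D : DyadicLattice} {w : ℝ → ℝ} {α : ℝ}

theorem A2Char_le_kInv (hα : 0 < α) (hw : IsWeight w) (hv : IsWeight w⁻¹)
    (hc : IsCarleson D (cSeq D α w)) :
    A2Char D w < ∞ ∧
      (A2Char D w).toReal ≤ kInv α (carlesonNorm D (cSeq D α w)).toReal := by
  have hfin := (isCarleson_iff.1 hc).2
  obtain ⟨h1, h2, h3⟩ := kFun_A2Char_le hw hv hα
    (C := (carlesonNorm D (cSeq D α w)).toReal) ENNReal.toReal_nonneg fun I => by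
      rw [ENNReal.ofReal_toReal hfin.ne, carlesonNorm_eq_iSup]
      exact le_iSup _ I
  exact ⟨h1, le_kInv hα ENNReal.toReal_nonneg h2 h3⟩

theorem isLUB_A2Char (D : DyadicLattice) (hα : 0 < α) {B : ℝ} (hB : 0 ≤ B) :
    IsLUB {q : ℝ≥0∞ | ∃ w : ℝ → ℝ, IsWeight w ∧ IsWeight w⁻¹ ∧ IsCarleson D (cSeq D α w) ∧
      carlesonNorm D (cSeq D α w) = ENNReal.ofReal B ∧ A2Char D w = q}
      (ENNReal.ofReal (kInv α B)) := by
  constructor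
  · rintro q ⟨w, hw, hv, hc, hnorm, rfl⟩
    obtain ⟨h1, h2⟩ := A2Char_le_kInv hα hw hv hc
    rw [hnorm, ENNReal.toReal_ofReal hB] at h2
    rw [← ENNReal.ofReal_toReal h1.ne]
    exact ENNReal.ofReal_le_ofReal h2
  · intro q hq
    have hmem : ∀ (N : ℕ) (r : ℝ), 1 ≤ r → rieszNorm α N r = B → ENNReal.ofReal (r ^ N) ≤ q := by
      intro N r hr hrB
      obtain ⟨w, hw, hv, hc, hnorm, hchar⟩ := exists_weight_rieszNorm D α N hr
      exact hq ⟨w, hw, hv, hc, by rw [hnorm, hrB], hchar⟩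
    rcases (kInv_mem hα hB).eq_or_lt with h | h
    -- Here no `Q ≥ 1` lies strictly below `k_α⁻¹(B) = 1`; the empty Riesz product `w = 1` attains
    -- the value.
    · have hB0 : B = 0 := by rw [← kFun_kInv hα hB, ← h, kFun_one]
      have := hmem 0 1 le_rfl (by simp [rieszNorm, hB0])
      rwa [pow_zero, h] at this
    · refine le_of_forall_lt fun a ha => ?_
      have ha' : a ≠ ∞ := (ha.trans ENNReal.ofReal_lt_top).ne
      rw [ENNReal.lt_ofReal_iff_toReal_lt ha'] at ha
      obtain ⟨Q, hQ1, hQ2⟩ := exists_between (max_lt ha h)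
      obtain ⟨N, r, hr, hrB, hQr⟩ := exists_rieszNorm_eq hα hB
        ((le_max_right _ _).trans hQ1.le) hQ2
      refine lt_of_lt_of_le ?_ (hmem N r hr hrB)
      rw [ENNReal.lt_ofReal_iff_toReal_lt ha']
      exact (le_max_left _ _).trans_lt (hQ1.trans_le hQr)

theorem isGLB_carlesonNorm (D : DyadicLattice) (hα : 0 < α) {Q : ℝ} (hQ : 1 ≤ Q) :
    IsGLB {b : ℝ≥0∞ | ∃ w : ℝ → ℝ, IsWeight w ∧ IsWeight w⁻¹ ∧
      A2Char D w = ENNReal.ofReal Q ∧ carlesonNorm D (cSeq D α w) = b}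
      (ENNReal.ofReal (kFun α Q)) := by
  have hQ0 : 0 ≤ Q := by linarith
  constructor
  · rintro b ⟨w, hw, hv, hchar, rfl⟩
    rcases eq_or_ne (carlesonNorm D (cSeq D α w)) ∞ with htop | hfin
    · rw [htop]
      exact le_top
    · obtain ⟨-, -, h⟩ := kFun_A2Char_le hw hv hα
        (C := (carlesonNorm D (cSeq D α w)).toReal) ENNReal.toReal_nonneg fun I => by
          rw [ENNReal.ofReal_toReal hfin, carlesonNorm_eq_iSup]
          exact le_iSup _ I
      rw [hchar, ENNReal.toReal_ofReal hQ0] at h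
      exact ENNReal.ofReal_le_of_le_toReal h
  · intro b hb
    refine ENNReal.le_of_forall_pos_le_add fun ε hε _ => ?_
    obtain ⟨N, hN0, hN⟩ := exists_rieszNorm_lt hQ (δ := kFun α Q + ε)
      (by have : (0 : ℝ) < ε := by exact_mod_cast hε
          linarith)
    obtain ⟨w, hw, hv, hc, hnorm, hchar⟩ := exists_weight_rieszNorm D α N
      (Real.one_le_rpow hQ (inv_nonneg.2 N.cast_nonneg))
    rw [Real.rpow_inv_natCast_pow hQ0 hN0] at hchar
    calc b ≤ ENNReal.ofReal (rieszNorm α N (Q ^ (N : ℝ)⁻¹)) := hb ⟨w, hw, hv, hchar, hnorm⟩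
      _ ≤ ENNReal.ofReal (kFun α Q + ε) := ENNReal.ofReal_le_ofReal hN.le
      _ ≤ ENNReal.ofReal (kFun α Q) + ENNReal.ofReal ε := ENNReal.ofReal_add_le
      _ = _ := by rw [ENNReal.ofReal_coe_nnreal]

end Estimate

/-! ### The counterexample for `α ≤ 0` -/

section Spikes

/-- The value of `spikeWeight` on the `M`-th interval of generation `0`. -/
def spikeValue (M : ℕ) : ℝ :=
  if 2 ≤ M ∧ M < 3 * 2 ^ (Nat.log 2 M - 1) then 2 ^ (Nat.log 2 M - 1) else 1

/-- The weight that equals `2 ^ i` on the third interval of generation `-i`, for `i ≥ 0`, and `1`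
elsewhere. -/
def spikeWeight (D : DyadicLattice) (x : ℝ) : ℝ := spikeValue (D.idx 0 x).toNat

variable {D : DyadicLattice}

lemma one_le_spikeValue (M : ℕ) : 1 ≤ spikeValue M := by
  rw [spikeValue]
  split_ifs
  · exact one_le_pow₀ one_le_two
  · exact le_rfl

lemma spikeValue_le (M : ℕ) : spikeValue M ≤ M + 1 := by
  rw [spikeValue]
  split_ifs with h
  · have h1 : 2 ^ (Nat.log 2 M - 1) ≤ M :=
      (Nat.pow_le_pow_right two_pos (Nat.sub_le _ _)).trans (Nat.pow_log_le_self 2 (by omega))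
    have h2 : ((2 ^ (Nat.log 2 M - 1) : ℕ) : ℝ) ≤ M := by exact_mod_cast h1
    push_cast at h2
    linarith
  · linarith [(Nat.cast_nonneg M : (0 : ℝ) ≤ M)]

/-- For `M ≥ 2` the spike condition says that the second leading binary digit of `M` is `0`.
Dropping the last `i` digits preserves it as long as two digits remain, that is, `m ≥ 2`. -/
lemma spikeValue_of_div {M m i : ℕ} (h : M / 2 ^ i = m) (hm : 2 ≤ m) :
    spikeValue M = if m < 3 * 2 ^ (Nat.log 2 m - 1) then 2 ^ (Nat.log 2 m - 1 + i) else 1 := by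
  have h2M : 2 ≤ M := hm.trans (h ▸ Nat.div_le_self _ _)
  have hlogm : 1 ≤ Nat.log 2 m := Nat.log_pos one_lt_two hm
  have hlog : Nat.log 2 M - 1 = Nat.log 2 m - 1 + i := by
    have := Nat.log_div_base_pow 2 M i
    rw [h] at this
    omega
  have hiff : M < 3 * 2 ^ (Nat.log 2 m - 1 + i) ↔ m < 3 * 2 ^ (Nat.log 2 m - 1) := by
    rw [← h, Nat.div_lt_iff_lt_mul (by positivity), h, pow_add, mul_assoc]
  rw [spikeValue, hlog]
  simp only [h2M, true_and, hiff]

lemma isWeight_spikeWeight : IsWeight (spikeWeight D) := by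
  have hcont : Continuous fun x : ℝ => |(x - D.pos) / D.len 0| + 1 := by fun_prop
  refine ⟨hcont.locallyIntegrable.mono ?_ ?_,
    Eventually.of_forall fun x => one_pos.trans_le (one_le_spikeValue _)⟩
  · have : Measurable fun m : ℤ => spikeValue m.toNat := measurable_of_countable _
    exact (this.comp (D.measurable_idx 0)).aestronglyMeasurable
  · refine Eventually.of_forall fun x => ?_
    rw [spikeWeight, Real.norm_of_nonneg (zero_le_one.trans (one_le_spikeValue _)),
      Real.norm_of_nonneg (by positivity)]
    refine (spikeValue_le _).trans (add_le_add_left ?_ 1)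
    rcases le_total 0 (D.idx 0 x) with h | h
    · have h1 : (((D.idx 0 x).toNat : ℤ) : ℝ) = D.idx 0 x := by rw [Int.toNat_of_nonneg h]
      rw [Int.cast_natCast] at h1
      rw [h1]
      exact (Int.floor_le _).trans (le_abs_self _)
    · rw [Int.toNat_of_nonpos h, Nat.cast_zero]
      positivity

lemma isWeight_inv_spikeWeight : IsWeight (spikeWeight D)⁻¹ := by
  refine ⟨(locallyIntegrable_const (1 : ℝ)).mono
    (isWeight_spikeWeight.1.aestronglyMeasurable.aemeasurable.inv.aestronglyMeasurable) ?_,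
    Eventually.of_forall fun x => inv_pos.2 (one_pos.trans_le (one_le_spikeValue _))⟩
  refine Eventually.of_forall fun x => ?_
  have h := one_le_spikeValue (D.idx 0 x).toNat
  rw [Pi.inv_apply, spikeWeight, norm_inv, norm_one, Real.norm_of_nonneg (by linarith)]
  exact inv_le_one_of_one_le₀ h

lemma idx_zero_div_of_mem {x : ℝ} {i : ℕ} {m : ℤ} (hx : x ∈ D.ivl (-i, m)) :
    D.idx 0 x / 2 ^ i = m := by
  have h := D.idx_add (-i) i x
  rw [neg_add_cancel] at h
  rw [← h]
  exact D.mem_ivl_iff.1 hx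

lemma spikeWeight_of_mem {x : ℝ} {i : ℕ} {m : ℕ} (hm : 2 ≤ m) (hx : x ∈ D.ivl (-i, m)) :
    spikeWeight D x =
      if m < 3 * 2 ^ (Nat.log 2 m - 1) then 2 ^ (Nat.log 2 m - 1 + i) else 1 := by
  have h := idx_zero_div_of_mem hx
  refine spikeValue_of_div ?_ hm
  have h0 : 0 ≤ D.idx 0 x := by
    by_contra! hneg
    have := Int.ediv_neg_of_neg_of_pos hneg (by positivity : (0 : ℤ) < 2 ^ i)
    omega
  zify
  rw [Int.toNat_of_nonneg h0]
  exact h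

/-- An interval of generation `n ≥ 0` lies in one unit cell. In coarser generations, a position `m ≥
2` fixes the spike value by its leading digits, and negative positions see the value `1`. -/
lemma exists_spikeWeight_eqOn {J : ℤ × ℤ} (h0 : J.2 ≠ 0) (h1 : J.2 ≠ 1) :
    ∃ c, ∀ x ∈ D.ivl J, spikeWeight D x = c := by
  obtain ⟨n, m⟩ := J
  rcases le_total 0 n with hn | hn
  · lift n to ℕ using hn
    refine ⟨spikeValue (m / 2 ^ n).toNat, fun x hx => ?_⟩
    have hx := D.mem_ivl_iff.1 hx
    rw [spikeWeight, D.idx_add 0 n, zero_add, hx]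
  · obtain ⟨i, rfl⟩ := Int.exists_eq_neg_ofNat hn
    rcases lt_or_ge m 0 with hm | hm
    · refine ⟨spikeValue 0, fun x hx => ?_⟩
      have h := idx_zero_div_of_mem hx
      have hneg : D.idx 0 x < 0 := by
        by_contra! hpos
        have := Int.ediv_nonneg hpos (by positivity : (0 : ℤ) ≤ 2 ^ i)
        omega
      rw [spikeWeight, Int.toNat_of_nonpos hneg.le]
    · lift m to ℕ using hm
      have hm2 : 2 ≤ m := by
        simp only at h0 h1
        omega
      exact ⟨_, fun x hx => spikeWeight_of_mem hm2 hx⟩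

lemma le_localChar_spikeWeight (i : ℕ) :
    2 ^ i / 4 ≤ localChar D (spikeWeight D) (-i - 1, 1) := by
  have hl : leftHalf (-(i : ℤ) - 1, 1) = (-(i : ℤ), ((2 : ℕ) : ℤ)) := by simp [leftHalf]
  have hr : rightHalf (-(i : ℤ) - 1, 1) = (-(i : ℤ), ((3 : ℕ) : ℤ)) := by simp [rightHalf]
  have e2 : ∀ x ∈ D.ivl (-(i : ℤ), ((2 : ℕ) : ℤ)), spikeWeight D x = 2 ^ i := fun x hx => by
    have hlog : Nat.log 2 2 = 1 := by decide
    rw [spikeWeight_of_mem le_rfl hx, hlog]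
    norm_num
  have e3 : ∀ x ∈ D.ivl (-(i : ℤ), ((3 : ℕ) : ℤ)), spikeWeight D x = 1 := fun x hx => by
    have hlog : Nat.log 2 3 = 1 := by decide
    rw [spikeWeight_of_mem (by norm_num) hx, hlog]
    norm_num
  have f2 : ∀ x ∈ D.ivl (-(i : ℤ), ((2 : ℕ) : ℤ)), (spikeWeight D)⁻¹ x = (2 ^ i)⁻¹ :=
    fun x hx => by rw [Pi.inv_apply, e2 x hx]
  have f3 : ∀ x ∈ D.ivl (-(i : ℤ), ((3 : ℕ) : ℤ)), (spikeWeight D)⁻¹ x = 1 :=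
    fun x hx => by rw [Pi.inv_apply, e3 x hx, inv_one]
  rw [localChar, avg_eq_half isWeight_spikeWeight.1, avg_eq_half isWeight_inv_spikeWeight.1, hl,
    hr, avg_of_eqOn e2, avg_of_eqOn e3, avg_of_eqOn f2, avg_of_eqOn f3]
  have h1 : (0 : ℝ) < 2 ^ i := by positivity
  have h2 : (2 : ℝ) ^ i * (2 ^ i)⁻¹ = 1 := mul_inv_cancel₀ h1.ne'
  have h3 : (0 : ℝ) < (2 ^ i)⁻¹ := inv_pos.2 h1
  nlinarith

lemma not_inA2_spikeWeight : ¬ InA2 D (spikeWeight D) := by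
  rintro ⟨-, -, h⟩
  obtain ⟨i, hi⟩ := pow_unbounded_of_one_lt (4 * (A2Char D (spikeWeight D)).toReal)
    (one_lt_two (α := ℝ))
  have h1 := (ENNReal.ofReal_le_ofReal (le_localChar_spikeWeight i)).trans
    (ofReal_localChar_le_A2Char (D := D) (w := spikeWeight D) (-i - 1, 1))
  rw [ENNReal.ofReal_le_iff_le_toReal h.ne] at h1
  linarith

/-- Here `t_J^α ≤ 1` because `t_J ≥ 1`, and `4 (a² + b²) ≤ 8`. This is where the sign of `α` enters.
-/
lemma cSeq_le_of_nonpos {w : ℝ → ℝ} (hw : IsWeight w) (hv : IsWeight w⁻¹) {α : ℝ} (hα : α ≤ 0)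
    (J : ℤ × ℤ) : cSeq D α w J ≤ 8 * D.len J.1 := by
  obtain ⟨a, b, ha, hb, -, -, h⟩ := exists_step hw hv D J
  rw [← div_le_iff₀ (D.len_pos _), h]
  have h1 : localChar D w J ^ α ≤ 1 :=
    Real.rpow_le_one_of_one_le_of_nonpos (one_le_localChar hw hv D J) hα
  have h2 : a ^ 2 < 1 := (sq_lt_one_iff_abs_lt_one a).2 ha
  have h3 : b ^ 2 < 1 := (sq_lt_one_iff_abs_lt_one b).2 hb
  calc _ ≤ 1 * (4 * (a ^ 2 + b ^ 2)) := mul_le_mul_of_nonneg_right h1 (by positivity)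
    _ ≤ 8 := by linarith

/-- Only positions `0` and `1` contribute, hence at most two intervals per generation below `I`;
their lengths sum geometrically. -/
lemma isCarleson_of_position {c : ℤ × ℤ → ℝ} {K : ℝ} (hc : ∀ J, 0 ≤ c J)
    (hK : ∀ J, c J ≤ K * D.len J.1) (h0 : ∀ J, J.2 ≠ 0 → J.2 ≠ 1 → c J = 0) :
    IsCarleson D c := by
  refine ⟨hc, ∑' k : ℕ, ENNReal.ofReal (2 * K) * 2⁻¹ ^ k, ?_, fun I => carlesonAvg_le_tsum ?_⟩
  · rw [ENNReal.tsum_mul_left, ENNReal.tsum_geometric]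
    exact ENNReal.mul_lt_top ENNReal.ofReal_lt_top (by norm_num)
  · intro k
    have hK0 : 0 ≤ K := by
      have := (hc I).trans (hK I)
      exact nonneg_of_mul_nonneg_left this (D.len_pos _)
    have hreal : ∑ j ∈ Finset.range (2 ^ k), c (descendant I k j) ≤
        2 * (K * D.len (I.1 + k)) := by
      set s := (Finset.range (2 ^ k)).filter fun j => c (descendant I k j) ≠ 0
      have hcard : s.card ≤ ({0, 1} : Finset ℤ).card := by
        refine Finset.card_le_card_of_injOn (fun j => (descendant I k j).2) (fun j hj => ?_) ?_
        · have hj := (Finset.mem_filter.1 hj).2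
          by_contra hmem
          simp only [Finset.coe_insert, Finset.coe_singleton, mem_insert_iff,
            mem_singleton_iff, not_or] at hmem
          exact hj (h0 _ hmem.1 hmem.2)
        · intro i _ j _ hij
          simpa [descendant] using hij
      rw [← Finset.sum_filter_ne_zero]
      calc _ ≤ s.card • (K * D.len (I.1 + k)) := Finset.sum_le_card_nsmul _ _ _ fun j _ => hK _
        _ ≤ 2 * (K * D.len (I.1 + k)) := by
          rw [nsmul_eq_mul]
          refine mul_le_mul_of_nonneg_right ?_ (mul_nonneg hK0 (D.len_pos _).le)
          exact_mod_cast hcard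
    have hpow : (2⁻¹ : ℝ≥0∞) ^ k = ENNReal.ofReal (2⁻¹ ^ k) := by
      rw [ENNReal.ofReal_pow (by norm_num), ENNReal.ofReal_inv_of_pos two_pos]
      simp
    rw [← ENNReal.ofReal_sum_of_nonneg fun j _ => hc _, hpow,
      ← ENNReal.ofReal_mul (by positivity), ← ENNReal.ofReal_mul (D.len_pos _).le]
    refine ENNReal.ofReal_le_ofReal (hreal.trans (le_of_eq ?_))
    rw [← D.len_add I.1 k, inv_pow]
    field_simp

theorem exists_carleson_not_inA2 (D : DyadicLattice) {α : ℝ} (hα : α ≤ 0) :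
    ∃ w : ℝ → ℝ, IsWeight w ∧ IsWeight w⁻¹ ∧ ¬ InA2 D w ∧ IsCarleson D (cSeq D α w) := by
  refine ⟨spikeWeight D, isWeight_spikeWeight, isWeight_inv_spikeWeight, not_inA2_spikeWeight,
    isCarleson_of_position (K := 8)
      (cSeq_nonneg isWeight_spikeWeight isWeight_inv_spikeWeight α)
      (cSeq_le_of_nonpos isWeight_spikeWeight isWeight_inv_spikeWeight hα) fun J h0 h1 => ?_⟩
  obtain ⟨c, hc⟩ := exists_spikeWeight_eqOn (D := D) h0 h1
  exact cSeq_of_eqOn α hc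

end Spikes

end

theorem corollary2p7 (D : DyadicLattice) (α : ℝ) :
    (0 < α →
      -- `k_α` is invertible as a map from `[1, ∞)` onto `[0, ∞)`
      BijOn (kFun α) (Ici 1) (Ici 0) ∧
      -- the estimate
      (∀ w : ℝ → ℝ, IsWeight w → IsWeight w⁻¹ → IsCarleson D (cSeq D α w) →
        InA2 D w ∧
          (A2Char D w).toReal ≤ kInv α (carlesonNorm D (cSeq D α w)).toReal) ∧
      -- sharpness: the bound is best possible for every value of the Carleson norm
      (∀ B : ℝ, 0 ≤ B →
        IsLUB {q : ℝ≥0∞ | ∃ w : ℝ → ℝ, IsWeight w ∧ IsWeight w⁻¹ ∧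
            IsCarleson D (cSeq D α w) ∧
            carlesonNorm D (cSeq D α w) = ENNReal.ofReal B ∧ A2Char D w = q}
          (ENNReal.ofReal (kInv α B))) ∧
      -- sharpness: `k_α(Q)` is the least Carleson norm (as an infimum) for characteristic `Q`
      (∀ Q : ℝ, 1 ≤ Q →
        IsGLB {b : ℝ≥0∞ | ∃ w : ℝ → ℝ, IsWeight w ∧ IsWeight w⁻¹ ∧
            A2Char D w = ENNReal.ofReal Q ∧ carlesonNorm D (cSeq D α w) = b}
          (ENNReal.ofReal (kFun α Q)))) ∧
    (α ≤ 0 →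
      ∃ w : ℝ → ℝ, IsWeight w ∧ IsWeight w⁻¹ ∧ ¬ InA2 D w ∧
        IsCarleson D (cSeq D α w)) := by
  refine ⟨fun hα => ⟨bijOn_kFun hα, fun w hw hv hc => ?_, fun B hB => isLUB_A2Char D hα hB,
    fun Q hQ => isGLB_carlesonNorm D hα hQ⟩, exists_carleson_not_inA2 D⟩
  obtain ⟨h1, h2⟩ := A2Char_le_kInv hα hw hv hc
  exact ⟨⟨hw, hv, h1⟩, h2⟩
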